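/- For $p\in(0,1)$, the random-surfer tree with parameter $p$ and $n$ vertices is defined as follows. Start with a single vertex $v_0$, the root, with a self-loop. At each step $s=1,\dots,n-1$ a new vertex $v_s$ appears; choose $u$ uniformly at random from $\{v_0,\dots,v_{s-1}\}$ and, independently of $u$ and of the past, a geometric random variable $X$ with $\mathbb P(X=k)=(1-p)^k p$ for $k=0,1,2,\dots$; starting from $u$, walk $X$ steps along the directed edges (one out-edge per vertex, so the walk stays at $v_0$ once it arrives there), and add a directed edge from $v_s$ to the last vertex of the walk. Finally delete the self-loop at $v_0$ and ignore the edge directions. The height of the tree is the maximum graph distance between a vertex and $v_0$; its diameter is the maximum graph distance between two vertices. All logarithms are natural. There is a unique $p_0\in(0,1/2)$ with $$\log\left(\frac{1-p_0}{p_0}\right)=\frac{1-p_0}{1-2p_0},$$ and for every $p\in(0,1)$ there is a unique $s=s(p)\in(0,1)$ with $$s\log\left(\frac{(1-p)(2-s)}{1-s}\right)=1.$$ Put $c_L(p)=\exp(1/s)\,s\,(2-s)\,p$ with $s=s(p)$. Then for every $p\in[p_0,1)$, asymptotically almost surely as $n\to\infty$, the height $H_n$ of the random-surfer tree with parameter $p$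 and $n$ vertices is asymptotic to $c_L(p)\log n$, and its diameter $D_n$ is asymptotic to $2c_L(p)\log n$; that is, for every fixed $\varepsilon>0$, $$\mathbb P\big(|H_n-c_L(p)\log n|\le\varepsilon\, c_L(p)\log n\big)\to1\quad\text{and}\quad \mathbb P\big(|D_n-2c_L(p)\log n|\le 2\varepsilon\, c_L(p)\log n\big)\to1 .$$ -/

import Mathlib

open Filter Topology ProbabilityTheory

noncomputable section

namespace RandomSurfer

/-- A directed multigraph on the vertices `0, …, m - 1` in which every vertex has out-degree `d`,
its out-edges being labelled by `Fin d`: `G v i` is the head of the `i`-th edge going out of `v`. -/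
abbrev OutGraph (d m : ℕ) : Type := Fin m → Fin d → Fin m

/-- The law of the last vertex of a simple random walk with `k` steps started at `u`: each step
follows a uniformly random out-edge of the current vertex. -/
def walk {d m : ℕ} [NeZero d] (G : OutGraph d m) : ℕ → Fin m → PMF (Fin m)
  | 0, u => PMF.pure u
  | k + 1, u => (PMF.uniformOfFintype (Fin d)).bind fun i => walk G k (G u i)

/-- The law of the head of one new edge: choose a uniformly random vertex `u` and, independently,
a geometric variable `X`, with `P(X = k) = (1 - p) ^ k * p`, then walk `X` steps from `u`. -/
def newHead {d m : ℕ} [NeZero d] [NeZero m] (p : unitInterval) (G : OutGraph d m) :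
    PMF (Fin m) :=
  (PMF.uniformOfFintype (Fin m)).bind fun u =>
    (geometricMeasure p).toPMF.bind fun X => walk G X u

/-- The law of `d` independent samples from `μ`. -/
def samples {α : Type} (μ : PMF α) : (d : ℕ) → PMF (Fin d → α)
  | 0 => PMF.pure Fin.elim0
  | d + 1 => μ.bind fun a => (samples μ d).map fun v => Fin.cons a v

/-- Add a new last vertex whose `i`-th out-edge goes to the old vertex `e i`. -/
def addVertex {d m : ℕ} (G : OutGraph d m) (e : Fin d → Fin m) : OutGraph d (m + 1) :=
  Fin.snoc (α := fun _ => Fin d → Fin (m + 1))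
    (fun v i => (G v i).castSucc) (fun i => (e i).castSucc)

/-- The law of the random-surfer Webgraph with parameters `p`, `d` after `n` steps; it then has
the `n + 1` vertices `v₀, …, vₙ`. It starts with the root `v₀` with `d` self-loops. -/
def webgraph (d : ℕ) [NeZero d] (p : unitInterval) : (n : ℕ) → PMF (OutGraph d (n + 1))
  | 0 => PMF.pure fun _ _ => 0
  | n + 1 => (webgraph d p n).bind fun G => (samples (newHead p G) d).map (addVertex G)

/-- The underlying simple graph: orientations are forgotten and self-loops are deleted. -/
def underlying {d m : ℕ} (G : OutGraph d m) : SimpleGraph (Fin m) :=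
  SimpleGraph.fromRel fun u v => ∃ i, G u i = v

/-- The law of the random-surfer tree with `n + 1` vertices; the root is the vertex `0`. -/
def tree (p : unitInterval) (n : ℕ) : PMF (SimpleGraph (Fin (n + 1))) :=
  (webgraph 1 p n).map underlying

/-- The maximum graph distance between a vertex and the root `0`. -/
def height {n : ℕ} (T : SimpleGraph (Fin (n + 1))) : ℕ :=
  Finset.univ.sup fun v => T.dist 0 v

/-- For random variables `X n` on discrete probability spaces with laws `μ n`: asymptotically
almost surely, `X n` is asymptotic to the deterministic sequence `f n`. -/
def AasAsymptotic {Ω : ℕ → Type} (μ : (n : ℕ) → PMF (Ω n)) (X : (n : ℕ) → Ω n → ℕ)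
    (f : ℕ → ℝ) : Prop :=
  ∀ ε : ℝ, 0 < ε →
    Tendsto (fun n => (μ n).toOuterMeasure {ω | |(X n ω : ℝ) - f n| ≤ ε * |f n|}) atTop (𝓝 1)

/-- `q` is a solution in `(0, 1/2)` of the equation that defines the threshold `p₀`. -/
def IsThreshold (q : ℝ) : Prop :=
  q ∈ Set.Ioo (0 : ℝ) (1 / 2) ∧ Real.log ((1 - q) / q) = (1 - q) / (1 - 2 * q)

/-- `s` is a solution in `(0, 1)` of the equation that defines `s(p)`. -/
def IsS (p s : ℝ) : Prop :=
  s ∈ Set.Ioo (0 : ℝ) 1 ∧ s * Real.log ((1 - p) * (2 - s) / (1 - s)) = 1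

/-- The value `c_L(p)`, written as a function of `p` and `s = s(p)`. -/
def cL (p s : ℝ) : ℝ := Real.exp (1 / s) * s * (2 - s) * p

end RandomSurfer

end

/-! A vertex attached after a walk of length X from u has depth one more than the depth of u minus
X, apart from walks absorbed at the root. Hence the expected sum of exp(l · depth) over n vertices
is at most about n^φ(l), where φ(l) = E exp(l(1 - X)) is `growth`, once φ(l) ≥ 1; otherwise the
absorbed walks dominate. The equation for s says that, for L = 1/s, the tangent to φ at L passes
through the origin, and c_L is its slope: φ(L) = L c_L and φ'(L) = c_L. The condition p ≥ p₀ yields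
φ(L) ≥ 1 (`one_le_growth`).

Upper bound: Markov's inequality for the exponential moment at L bounds all depths
(`eventually_Pr_lt_depth_le`). As the diameter is at most twice the height, it remains to bound the
diameter from below.

Lower bound: summing exp((l + iw) · depth) gives a quantity whose mean is multiplied by about 1 +
φ(l + iw)/t when the t-th graph gains a vertex. Its imaginary part, cut off to one half-period of
the sine, is a bump that travels at speed close to φ'(l) in log t and is a subsolution of the mean
recursion (`modulus_mul_bump_le`). The rescaled bump summed over descendants of the oldest vertices
is thus a submartingale. For l slightly below L its squared increments have summable means, so a
one-sided Chebyshev bound (`Ex_sq_max_sub_vertexSum_le`) shows that descendants of half of the a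
oldest vertices reach relative depth (c_L - ε) log n with probability 1 - O(1/a). Applied to two
complementary halves, this gives two deep vertices whose paths to the oldest vertices are disjoint,
hence a large diameter. -/

namespace RandomSurfer

/-! ### Expectations over finite probability spaces -/

/-- The expectation of `F` under a law on a finite type. -/
noncomputable def Ex {α : Type*} [Fintype α] (μ : PMF α) (F : α → ℝ) : ℝ :=
  ∑ a, (μ a).toReal * F a

section Expectation

variable {α β : Type*} [Fintype α] [Fintype β]

lemma sum_toReal (μ : PMF α) : ∑ a, (μ a).toReal = 1 := by
  rw [← ENNReal.toReal_sum (fun a _ => μ.apply_ne_top a), ← tsum_fintype (L := .unconditional _), μ.tsum_coe]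
  rfl

lemma Ex_const (μ : PMF α) (c : ℝ) : Ex μ (fun _ => c) = c := by
  rw [Ex, ← Finset.sum_mul, sum_toReal, one_mul]

lemma Ex_mono {μ : PMF α} {F F' : α → ℝ} (h : ∀ a ∈ μ.support, F a ≤ F' a) : Ex μ F ≤ Ex μ F' := by
  refine Finset.sum_le_sum fun a _ => ?_
  by_cases ha : a ∈ μ.support
  · exact mul_le_mul_of_nonneg_left (h a ha) ENNReal.toReal_nonneg
  · rw [(μ.apply_eq_zero_iff a).2 ha]; simp

lemma Ex_nonneg {μ : PMF α} {F : α → ℝ} (h : ∀ a, 0 ≤ F a) : 0 ≤ Ex μ F :=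
  Finset.sum_nonneg fun a _ => mul_nonneg ENNReal.toReal_nonneg (h a)

lemma Ex_add (μ : PMF α) (F F' : α → ℝ) : Ex μ (fun a => F a + F' a) = Ex μ F + Ex μ F' := by
  simp [Ex, mul_add, Finset.sum_add_distrib]

lemma Ex_mul_left (μ : PMF α) (c : ℝ) (F : α → ℝ) : Ex μ (fun a => c * F a) = c * Ex μ F := by
  simp only [Ex, Finset.mul_sum]
  exact Finset.sum_congr rfl fun a _ => by ring

lemma Ex_pure (a : α) (F : α → ℝ) : Ex (PMF.pure a) F = F a := by
  classical
  simp [Ex, PMF.pure_apply, apply_ite ENNReal.toReal, ite_mul]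

lemma Ex_bind (μ : PMF α) (κ : α → PMF β) (F : β → ℝ) :
    Ex (μ.bind κ) F = Ex μ fun a => Ex (κ a) F := by
  simp only [Ex, PMF.bind_apply, tsum_fintype, Finset.mul_sum]
  rw [Finset.sum_comm]
  refine Finset.sum_congr rfl fun b _ => ?_
  rw [ENNReal.toReal_sum fun a _ => ENNReal.mul_ne_top (μ.apply_ne_top a) ((κ a).apply_ne_top b),
    Finset.sum_mul]
  exact Finset.sum_congr rfl fun a _ => by rw [ENNReal.toReal_mul, mul_assoc]

lemma Ex_map (μ : PMF α) (f : α → β) (F : β → ℝ) : Ex (μ.map f) F = Ex μ fun a => F (f a) := by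
  rw [← PMF.bind_pure_comp, Ex_bind]
  simp [Ex_pure]

lemma Ex_uniform [Nonempty α] (F : α → ℝ) :
    Ex (PMF.uniformOfFintype α) F = (Fintype.card α : ℝ)⁻¹ * ∑ a, F a := by
  simp [Ex, Finset.mul_sum]

/-- Expectation of a function of a natural-number-valued random variable. -/
lemma hasSum_Ex_map (κ : PMF ℕ) (f : ℕ → α) (F : α → ℝ) :
    HasSum (fun k => (κ k).toReal * F (f k)) (Ex (κ.map f) F) := by
  classical
  have hs : Summable fun k => (κ k).toReal := ENNReal.summable_toReal κ.tsum_coe_ne_top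
  have h1 : ∀ a, HasSum (fun k => (if a = f k then (κ k).toReal else 0) * F a)
      ((κ.map f a).toReal * F a) := by
    intro a
    refine HasSum.mul_right _ ?_
    rw [PMF.map_apply, ENNReal.tsum_toReal_eq (fun k => by split_ifs <;> simp [κ.apply_ne_top])]
    have : Summable fun k => (if a = f k then κ k else 0).toReal := by
      refine hs.of_nonneg_of_le (fun _ => ENNReal.toReal_nonneg) fun k => ?_
      split_ifs <;> simp
    have e : (fun k => if a = f k then (κ k).toReal else 0) =
        fun k => (if a = f k then κ k else 0).toReal := by ext k; split_ifs <;> simp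
    rw [e]
    exact this.hasSum
  have h2 := hasSum_sum (s := Finset.univ) fun a _ => h1 a
  simpa [ite_mul, Ex] using h2

end Expectation

/-! ### The process with out-degree one -/

/-- The out-neighbour of a vertex in a graph of out-degree one. -/
def step {m : ℕ} (G : OutGraph 1 m) (v : Fin m) : Fin m := G v 0

lemma walk_one {m : ℕ} (G : OutGraph 1 m) (k : ℕ) (u : Fin m) :
    walk G k u = PMF.pure ((step G)^[k] u) := by
  induction k generalizing u with
  | zero => rfl
  | succ k ih =>
    have : (PMF.uniformOfFintype (Fin 1)) = PMF.pure 0 := by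
      ext i; fin_cases i; simp
    rw [walk, this, PMF.pure_bind, ih, Function.iterate_succ_apply]
    rfl

/-- The weights of the geometric law. -/
noncomputable def geom (p : ℝ) (k : ℕ) : ℝ := (1 - p) ^ k * p

lemma geom_nonneg {p : ℝ} (h0 : 0 ≤ p) (h1 : p ≤ 1) (k : ℕ) : 0 ≤ geom p k :=
  mul_nonneg (pow_nonneg (by linarith) k) h0

section NewHead

variable {p : unitInterval} {m : ℕ} [NeZero m]

lemma Ex_newHead (p : unitInterval) (G : OutGraph 1 m) (F : Fin m → ℝ) :
    Ex (newHead p G) F =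
      (m : ℝ)⁻¹ * ∑ u, Ex ((geometricMeasure p).toPMF.map fun k => (step G)^[k] u) F := by
  rw [newHead, Ex_bind, Ex_uniform, Fintype.card_fin]
  congr 2 with u
  rw [← PMF.bind_pure_comp]
  simp only [walk_one]
  rfl

lemma hasSum_Ex_geometric (hp : p ≠ 0) {α : Type*} [Fintype α] (f : ℕ → α) (F : α → ℝ) :
    HasSum (fun k => geom p k * F (f k)) (Ex ((geometricMeasure p).toPMF.map f) F) := by
  convert hasSum_Ex_map (geometricMeasure p).toPMF f F using 3 with k
  rw [MeasureTheory.Measure.toPMF_apply, geometricMeasure_singleton hp,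
    ENNReal.toReal_ofReal (geometricMeasure_nonneg p k), geom]

lemma Ex_newHead_ge (hp : p ≠ 0) (G : OutGraph 1 m) {F : Fin m → ℝ} (hF : ∀ v, 0 ≤ F v)
    (K : ℕ) :
    (m : ℝ)⁻¹ * ∑ u, ∑ k ∈ Finset.range K, geom p k * F ((step G)^[k] u) ≤
      Ex (newHead p G) F := by
  rw [Ex_newHead]
  gcongr with u
  exact sum_le_hasSum _ (fun k _ => mul_nonneg (geom_nonneg p.2.1 p.2.2 k) (hF _))
    (hasSum_Ex_geometric hp _ F)

lemma Ex_newHead_le (hp : p ≠ 0) (G : OutGraph 1 m) {F : Fin m → ℝ} {h : Fin m → ℕ → ℝ}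
    {c : Fin m → ℝ} (hF : ∀ u k, geom p k * F ((step G)^[k] u) ≤ h u k)
    (hc : ∀ u, HasSum (h u) (c u)) :
    Ex (newHead p G) F ≤ (m : ℝ)⁻¹ * ∑ u, c u := by
  rw [Ex_newHead]
  gcongr with u
  exact hasSum_le (hF u) (hasSum_Ex_geometric hp _ F) (hc u)

end NewHead

lemma webgraph_one_succ (p : unitInterval) (n : ℕ) :
    webgraph 1 p (n + 1) = (webgraph 1 p n).bind fun G =>
      (newHead p G).map fun e => addVertex G fun _ => e := by
  rw [webgraph]
  congr with G : 1
  simp only [samples, PMF.pure_map, PMF.map_bind]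
  rw [← PMF.bind_pure_comp]
  congr with e : 1
  simp only [Function.comp]
  congr 2 with i
  fin_cases i
  rfl

lemma Ex_webgraph_succ (p : unitInterval) (n : ℕ) (F : OutGraph 1 (n + 2) → ℝ) :
    Ex (webgraph 1 p (n + 1)) F = Ex (webgraph 1 p n) fun G =>
      Ex (newHead p G) fun e => F (addVertex G fun _ => e) := by
  rw [webgraph_one_succ, Ex_bind]
  simp only [Ex_map]

lemma step_addVertex_castSucc {m : ℕ} (G : OutGraph 1 m) (e : Fin m) (v : Fin m) :
    step (addVertex G fun _ => e) v.castSucc = (step G v).castSucc := by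
  simp [step, addVertex]

lemma step_addVertex_last {m : ℕ} (G : OutGraph 1 m) (e : Fin m) :
    step (addVertex G fun _ => e) (Fin.last m) = e.castSucc := by
  simp [step, addVertex]

/-- Every out-edge except the loop at the root goes to an older vertex. -/
def Recursive {m : ℕ} (G : OutGraph 1 m) : Prop := ∀ v, (step G v).val ≤ v.val - 1

lemma Recursive.addVertex {m : ℕ} {G : OutGraph 1 m} (hG : Recursive G) (e : Fin m) :
    Recursive (addVertex G fun _ => e) := by
  intro v
  induction v using Fin.lastCases with
  | last => rw [step_addVertex_last]; simp; omega
  | cast v => rw [step_addVertex_castSucc]; exact hG v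

lemma recursive_of_mem_support {p : unitInterval} {n : ℕ} {G : OutGraph 1 (n + 1)}
    (h : G ∈ (webgraph 1 p n).support) : Recursive G := by
  induction n with
  | zero => intro v; have := (step G v).2; omega
  | succ n ih =>
    rw [webgraph_one_succ, PMF.mem_support_bind_iff] at h
    obtain ⟨G', hG', h⟩ := h
    rw [PMF.mem_support_map_iff] at h
    obtain ⟨e, -, rfl⟩ := h
    exact (ih hG').addVertex e

/-! ### Depth relative to the oldest vertices -/

section Depth

variable {m : ℕ} (a : ℕ) (G : OutGraph 1 m)

/-- The number of steps from `v` to the first vertex among the `a` oldest ones. -/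
noncomputable def depth (v : Fin m) : ℕ := sInf {k | ((step G)^[k] v).val < a}

/-- The first vertex among the `a` oldest ones on the walk from `v`. -/
noncomputable def base (v : Fin m) : ℕ := ((step G)^[depth a G v] v).val

variable {a G}

lemma iterate_le (hG : Recursive G) (k : ℕ) (v : Fin m) : ((step G)^[k] v).val ≤ v.val - k := by
  induction k with
  | zero => simp
  | succ k ih =>
    rw [Function.iterate_succ_apply']
    have := hG ((step G)^[k] v)
    omega

lemma base_lt (ha : 0 < a) (hG : Recursive G) (v : Fin m) : base a G v < a :=
  Nat.sInf_mem (s := {k | ((step G)^[k] v).val < a})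
    -- After `v.val` steps the walk is at the root, so the set is nonempty and the infimum is
    -- attained rather than the default 0.
    ⟨v.val, by have := iterate_le hG v.val v; simp only [Set.mem_ofPred_eq]; omega⟩

lemma depth_le {v : Fin m} {k : ℕ} (h : ((step G)^[k] v).val < a) : depth a G v ≤ k :=
  Nat.sInf_le h

lemma depth_of_lt {v : Fin m} (h : v.val < a) : depth a G v = 0 :=
  Nat.le_zero.1 (depth_le (k := 0) h)

lemma base_of_lt {v : Fin m} (h : v.val < a) : base a G v = v.val := by
  rw [base, depth_of_lt h]; rfl

lemma depth_iterate (ha : 0 < a) (hG : Recursive G) {v : Fin m} {k : ℕ} (hk : k ≤ depth a G v) :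
    depth a G ((step G)^[k] v) = depth a G v - k := by
  have h1 := base_lt ha hG v
  have h2 := base_lt ha hG ((step G)^[k] v)
  rw [base, ← Function.iterate_add_apply] at h2
  apply le_antisymm
  · apply depth_le
    rw [← Function.iterate_add_apply, Nat.sub_add_cancel hk]
    exact h1
  · have := depth_le h2
    omega

lemma base_iterate (ha : 0 < a) (hG : Recursive G) {v : Fin m} {k : ℕ} (hk : k ≤ depth a G v) :
    base a G ((step G)^[k] v) = base a G v := by
  rw [base, depth_iterate ha hG hk, ← Function.iterate_add_apply, Nat.sub_add_cancel hk, base]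

/-- Beyond the depth of v the walk is among the `a` oldest vertices and never leaves them, because
out-edges lead to older vertices or loop at the root. -/
lemma depth_iterate_le (ha : 0 < a) (hG : Recursive G) (v : Fin m) (k : ℕ) :
    depth a G ((step G)^[k] v) ≤ depth a G v - k := by
  rcases le_total k (depth a G v) with hk | hk
  · exact (depth_iterate ha hG hk).le
  · rw [depth_of_lt]
    · simp
    · obtain ⟨j, rfl⟩ := Nat.exists_eq_add_of_le' hk
      rw [Function.iterate_add_apply]
      have h1 := base_lt ha hG v
      have h2 := iterate_le hG j ((step G)^[depth a G v] v)
      rw [base] at h1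
      omega

lemma depth_step (ha : 0 < a) (hG : Recursive G) {v : Fin m} (hv : a ≤ v.val) :
    depth a G v = depth a G (step G v) + 1 ∧ base a G v = base a G (step G v) := by
  have h0 : 1 ≤ depth a G v := by
    by_contra! h
    have h1 := base_lt ha hG v
    rw [base, Nat.lt_one_iff.1 h] at h1
    exact absurd h1 (by simpa using hv)
  have h1 := depth_iterate ha hG h0
  have h2 := base_iterate ha hG h0
  rw [Function.iterate_one] at h1 h2
  exact ⟨by omega, h2.symm⟩

lemma iterate_addVertex_castSucc (e : Fin m) (k : ℕ) (v : Fin m) :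
    (step (addVertex G fun _ => e))^[k] v.castSucc = ((step G)^[k] v).castSucc := by
  induction k with
  | zero => rfl
  | succ k ih => rw [Function.iterate_succ_apply', ih, step_addVertex_castSucc,
      Function.iterate_succ_apply']

lemma depth_addVertex_castSucc (e : Fin m) (v : Fin m) :
    depth a (addVertex G fun _ => e) v.castSucc = depth a G v := by
  simp only [depth, iterate_addVertex_castSucc, Fin.val_castSucc]

lemma base_addVertex_castSucc (e : Fin m) (v : Fin m) :
    base a (addVertex G fun _ => e) v.castSucc = base a G v := by
  rw [base, depth_addVertex_castSucc, iterate_addVertex_castSucc, base, Fin.val_castSucc]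

lemma depth_addVertex_last (ha : 0 < a) (ham : a ≤ m) (hG : Recursive G) (e : Fin m) :
    depth a (addVertex G fun _ => e) (Fin.last m) = depth a G e + 1 ∧
      base a (addVertex G fun _ => e) (Fin.last m) = base a G e := by
  have := depth_step ha (hG.addVertex e) (v := Fin.last m) (by simpa using ham)
  rwa [step_addVertex_last, depth_addVertex_castSucc, base_addVertex_castSucc] at this

/-- The sum over all vertices of a function of base and depth. -/
noncomputable def vertexSum (a : ℕ) (G : OutGraph 1 m) (f : ℕ → ℕ → ℝ) : ℝ :=
  ∑ v, f (base a G v) (depth a G v)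

lemma vertexSum_addVertex (ha : 0 < a) (ham : a ≤ m) (hG : Recursive G) (e : Fin m)
    (f : ℕ → ℕ → ℝ) :
    vertexSum a (addVertex G fun _ => e) f =
      vertexSum a G f + f (base a G e) (depth a G e + 1) := by
  rw [vertexSum, Fin.sum_univ_castSucc]
  simp only [depth_addVertex_castSucc, base_addVertex_castSucc,
    depth_addVertex_last ha ham hG e]
  rfl

lemma vertexSum_of_le (hm : m ≤ a) (f : ℕ → ℕ → ℝ) :
    vertexSum a G f = ∑ v : Fin m, f v 0 := by
  refine Finset.sum_congr rfl fun v _ => ?_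
  rw [depth_of_lt (by omega), base_of_lt (by omega)]

end Depth

/-! ### Exponential moments of the depths -/

/-- The exponential moment at `l` of the depth increment `1 - X`. -/
noncomputable def growth (p l : ℝ) : ℝ := p * Real.exp l / (1 - (1 - p) * Real.exp (-l))

lemma mul_exp_neg_lt_one {p l : ℝ} (hp : 0 < p) (hl : 0 ≤ l) :
    (1 - p) * Real.exp (-l) < 1 := by
  have h : Real.exp (-l) ≤ 1 := by rw [Real.exp_le_one_iff]; linarith
  nlinarith [Real.exp_pos (-l)]

lemma growth_pos {p l : ℝ} (hp : 0 < p) (hl : 0 ≤ l) : 0 < growth p l :=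
  div_pos (mul_pos hp (Real.exp_pos l)) (by linarith [mul_exp_neg_lt_one hp hl])

lemma hasSum_geom {p : ℝ} (hp : 0 < p) (hp1 : p ≤ 1) : HasSum (geom p) 1 := by
  have h := (hasSum_geometric_of_lt_one (r := 1 - p) (by linarith) (by linarith)).mul_right p
  rwa [sub_sub_cancel, inv_mul_cancel₀ hp.ne'] at h

lemma hasSum_geom_mul_exp {p l : ℝ} (hp : 0 < p) (hp1 : p ≤ 1) (hl : 0 ≤ l) :
    HasSum (fun k : ℕ => geom p k * Real.exp (l * (1 - k))) (growth p l) := by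
  have h := (hasSum_geometric_of_lt_one (r := (1 - p) * Real.exp (-l))
    (mul_nonneg (by linarith) (Real.exp_pos _).le) (mul_exp_neg_lt_one hp hl)).mul_left
    (p * Real.exp l)
  rw [← div_eq_mul_inv] at h
  change HasSum _ (growth p l) at h
  refine (congrArg (fun f => HasSum f (growth p l)) (funext fun k => ?_)).mpr h
  rw [geom, mul_pow, ← Real.exp_nat_mul, show l * (1 - k) = l + k * -l by ring, Real.exp_add]
  ring

section Moment

variable {p : unitInterval} {a : ℕ}

/-- If the walk is no longer than the depth of its start u, the depth drops by at least its length;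
if it is at least as long, the new vertex has relative depth 1 and contributes exp l. Adding both
bounds for every length avoids a case split in the sum. -/
lemma Ex_newHead_exp_le (hp : 0 < (p : ℝ)) (ha : 0 < a) {l : ℝ} (hl : 0 ≤ l) {m : ℕ} [NeZero m]
    {G : OutGraph 1 m} (hG : Recursive G) :
    Ex (newHead p G) (fun e => Real.exp (l * (depth a G e + 1 : ℕ))) ≤
      (m : ℝ)⁻¹ * (growth p l * vertexSum a G fun _ d => Real.exp (l * d)) + Real.exp l := by
  have hp0 : p ≠ 0 := fun h => by simp [h] at hp
  have hp1 : (p : ℝ) ≤ 1 := p.2.2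
  have hm : (m : ℝ) ≠ 0 := Nat.cast_ne_zero.2 (NeZero.ne m)
  refine (Ex_newHead_le hp0 G (h := fun u k => geom p k * Real.exp (l * (1 - k)) *
    Real.exp (l * depth a G u) + geom p k * Real.exp l) ?_ fun u =>
    ((hasSum_geom_mul_exp hp hp1 hl).mul_right _).add
      ((hasSum_geom hp hp1).mul_right _)).trans_eq ?_
  · intro u k
    rw [mul_assoc, ← mul_add, ← Real.exp_add]
    refine mul_le_mul_of_nonneg_left ?_ (geom_nonneg hp.le hp1 k)
    have h := depth_iterate_le ha hG u k
    rcases le_total k (depth a G u) with hk | hk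
    · refine le_add_of_le_of_nonneg (Real.exp_le_exp.2 ?_) (Real.exp_pos _).le
      rw [← mul_add]
      refine mul_le_mul_of_nonneg_left ?_ hl
      have : (depth a G ((step G)^[k] u) : ℝ) + k ≤ depth a G u := by
        exact_mod_cast (by omega : _ + k ≤ depth a G u)
      push_cast
      linarith
    · rw [show depth a G ((step G)^[k] u) = 0 by omega]
      simpa using (Real.exp_pos _).le
  · rw [Finset.sum_add_distrib, ← Finset.mul_sum, vertexSum]
    simp
    field_simp

lemma Ex_vertexSum_succ (ha : 0 < a) {n : ℕ} (hn : a ≤ n + 1) (f : ℕ → ℕ → ℝ) :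
    Ex (webgraph 1 p (n + 1)) (fun G => vertexSum a G f) =
      Ex (webgraph 1 p n) (fun G => vertexSum a G f) + Ex (webgraph 1 p n) (fun G =>
        Ex (newHead p G) fun e => f (base a G e) (depth a G e + 1)) := by
  rw [Ex_webgraph_succ, ← Ex_add]
  have key : ∀ G ∈ (webgraph 1 p n).support,
      (Ex (newHead p G) fun e => vertexSum a (addVertex G fun _ => e) f) =
        vertexSum a G f + Ex (newHead p G) fun e => f (base a G e) (depth a G e + 1) := by
    intro G hG
    simp only [vertexSum_addVertex ha hn (recursive_of_mem_support hG), Ex_add, Ex_const]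
  exact le_antisymm (Ex_mono fun G hG => (key G hG).le) (Ex_mono fun G hG => (key G hG).ge)

lemma Ex_Ex_exp_le (hp : 0 < (p : ℝ)) (ha : 0 < a) {l : ℝ} (hl : 0 ≤ l) (n : ℕ) :
    Ex (webgraph 1 p n) (fun G => Ex (newHead p G) fun e =>
        Real.exp (l * (depth a G e + 1 : ℕ))) ≤
      ((n + 1 : ℕ) : ℝ)⁻¹ * (growth p l *
        Ex (webgraph 1 p n) fun G => vertexSum a G fun _ d => Real.exp (l * d)) +
        Real.exp l := by
  refine (Ex_mono fun G hG => Ex_newHead_exp_le hp ha hl (recursive_of_mem_support hG)).trans_eq ?_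
  rw [Ex_add, Ex_mul_left, Ex_mul_left, Ex_const]

/-- The expected sum W at t vertices grows to at most (1 + φ/t) W + exp l. Bernoulli's inequality
gives the bound an extra factor 1 + (φ + η)/t; since φ + η ≥ 1, the bound is at least B t, so its
surplus η/t absorbs exp l. -/
theorem Ex_vertexSum_exp_le (hp : 0 < (p : ℝ)) {b : ℕ} {l η B : ℝ} (hl : 0 ≤ l)
    (hη : 1 ≤ growth p l + η) (hB : 1 ≤ B) (hBη : Real.exp l ≤ B * η) {n : ℕ} (hn : b ≤ n) :
    Ex (webgraph 1 p n) (fun G => vertexSum (b + 1) G fun _ d => Real.exp (l * d)) ≤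
      B * ((b + 1 : ℕ) : ℝ) * (((n + 1 : ℕ) : ℝ) / ((b + 1 : ℕ) : ℝ)) ^ (growth p l + η) := by
  induction n, hn using Nat.le_induction with
  | base =>
    simp only [vertexSum_of_le le_rfl]
    rw [div_self (by positivity)]
    simp only [CharP.cast_eq_zero, mul_zero, Real.exp_zero, Finset.sum_const, Finset.card_univ,
      Fintype.card_fin, nsmul_eq_mul, mul_one, Ex_const, Real.one_rpow]
    nlinarith [(Nat.cast_nonneg (b + 1) : (0 : ℝ) ≤ _)]
  | succ n hn ih =>
    rw [Ex_vertexSum_succ (by omega) (by omega)]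
    have h1 := Ex_Ex_exp_le (p := p) (a := b + 1) hp (by omega) hl n
    set W := Ex (webgraph 1 p n) (fun G => vertexSum (b + 1) G fun _ d => Real.exp (l * d))
    have hφ := growth_pos hp hl
    set φ := growth p l
    have ht : (0 : ℝ) < (n + 1 : ℕ) := by positivity
    have ha : (0 : ℝ) < (b + 1 : ℕ) := by positivity
    have hat : ((b + 1 : ℕ) : ℝ) ≤ (n + 1 : ℕ) := by exact_mod_cast (by omega)
    have hsucc : ((n + 1 + 1 : ℕ) : ℝ) = (n + 1 : ℕ) + 1 := by push_cast; ring
    rw [hsucc]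
    set t : ℝ := ((n + 1 : ℕ) : ℝ)
    set a : ℝ := ((b + 1 : ℕ) : ℝ)
    have hx : 1 ≤ t / a := (one_le_div ha).2 hat
    have hxψ : t / a ≤ (t / a) ^ (φ + η) := Real.self_le_rpow_of_one_le hx hη
    have hbern : 1 + (φ + η) * (1 / t) ≤ (1 + 1 / t) ^ (φ + η) :=
      one_add_mul_self_le_rpow_one_add (by linarith [one_div_pos.2 ht]) hη
    have hsplit : ((t + 1) / a) ^ (φ + η) = (t / a) ^ (φ + η) * (1 + 1 / t) ^ (φ + η) := by
      rw [← Real.mul_rpow (by positivity) (by positivity)]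
      congr 1
      field_simp
    rw [hsplit]
    set X := (t / a) ^ (φ + η)
    have hX : 0 < X := by linarith
    have h2 : W * (1 + φ / t) ≤ B * a * X * (1 + φ / t) :=
      mul_le_mul_of_nonneg_right ih (by positivity)
    have h3 : Real.exp l ≤ B * a * X * (η / t) := by
      have h4 : 1 ≤ a * X / t := by
        rw [one_le_div ht]
        rw [div_le_iff₀ ha] at hxψ
        linarith
      have h5 : 0 ≤ B * η := (Real.exp_pos l).le.trans hBη
      calc Real.exp l ≤ B * η * 1 := by linarith
        _ ≤ B * η * (a * X / t) := mul_le_mul_of_nonneg_left h4 h5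
        _ = _ := by ring
    have h6 := mul_le_mul_of_nonneg_left hbern (by positivity : 0 ≤ B * a * X)
    calc _ ≤ W + (t⁻¹ * (φ * W) + Real.exp l) := by gcongr
      _ = W * (1 + φ / t) + Real.exp l := by ring
      _ ≤ B * a * X * (1 + φ / t) + B * a * X * (η / t) := add_le_add h2 h3
      _ = B * a * X * (1 + (φ + η) * (1 / t)) := by ring
      _ ≤ _ := h6.trans_eq (by ring)

theorem Ex_Ex_exp_le_rpow (hp : 0 < (p : ℝ)) {b : ℕ} {l η B : ℝ} (hl : 0 ≤ l)
    (hη : 1 ≤ growth p l + η) (hB : 1 ≤ B) (hBη : Real.exp l ≤ B * η) {n : ℕ} (hn : b ≤ n) :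
    Ex (webgraph 1 p n) (fun G => Ex (newHead p G) fun e =>
        Real.exp (l * (depth (b + 1) G e + 1 : ℕ))) ≤
      (growth p l * B + Real.exp l) *
        (((n + 1 : ℕ) : ℝ) / ((b + 1 : ℕ) : ℝ)) ^ (growth p l + η - 1) := by
  refine (Ex_Ex_exp_le hp (by omega) hl n).trans ?_
  have h1 := Ex_vertexSum_exp_le hp hl hη hB hBη hn
  have hφ := growth_pos hp hl
  set φ := growth p l
  have ht : (0 : ℝ) < (n + 1 : ℕ) := by positivity
  have ha : (0 : ℝ) < (b + 1 : ℕ) := by positivity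
  have hat : ((b + 1 : ℕ) : ℝ) ≤ (n + 1 : ℕ) := by exact_mod_cast (by omega)
  set t : ℝ := ((n + 1 : ℕ) : ℝ)
  set a : ℝ := ((b + 1 : ℕ) : ℝ)
  have hx : 1 ≤ t / a := (one_le_div ha).2 hat
  have hX : 1 ≤ (t / a) ^ (φ + η - 1) := Real.one_le_rpow hx (by linarith)
  have hs : (t / a) ^ (φ + η) = (t / a) ^ (φ + η - 1) * (t / a) := by
    rw [← Real.rpow_add_one (by positivity)]; ring_nf
  rw [hs] at h1
  set X := (t / a) ^ (φ + η - 1)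
  calc _ ≤ t⁻¹ * (φ * (B * a * (X * (t / a)))) + Real.exp l * X := by
        gcongr; exact le_mul_of_one_le_right (Real.exp_pos _).le hX
    _ = _ := by field_simp

end Moment

/-! ### A lower tail bound for vertex sums that are submartingales -/

section LowerTail

/-- Second-order expansion of max(w, 0)², whose second derivative is at most 2. -/
lemma sq_max_sub_le (w z : ℝ) : max (w - z) 0 ^ 2 ≤ max w 0 ^ 2 - 2 * max w 0 * z + z ^ 2 := by
  rcases le_total 0 w with hw | hw
  · rw [max_eq_left hw]
    rcases le_total 0 (w - z) with h | h
    · rw [max_eq_left h]; nlinarith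
    · rw [max_eq_right h]; nlinarith [sq_nonneg (w - z)]
  · rw [max_eq_right hw]
    rcases le_total 0 (w - z) with h | h
    · rw [max_eq_left h]; nlinarith
    · rw [max_eq_right h]; nlinarith [sq_nonneg z]

/-- One step of the submartingale: expand about the mean, where the linear term cancels and the
variance is at most the second moment. The positive part makes a lower bound on the drift
sufficient. -/
lemma Ex_sq_max_sub_le {α : Type*} [Fintype α] (μ : PMF α) (F : α → ℝ) {c A x : ℝ}
    (h : x ≤ A + Ex μ F) :
    Ex μ (fun e => max (c - (A + F e)) 0 ^ 2) ≤ max (c - x) 0 ^ 2 + Ex μ fun e => F e ^ 2 := by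
  set M := Ex μ F
  set w := c - (A + M)
  have h1 : Ex μ (fun e => max (c - (A + F e)) 0 ^ 2) ≤
      Ex μ (fun e => (max w 0 ^ 2 + 2 * max w 0 * M + M ^ 2) +
        ((-(2 * max w 0 + 2 * M)) * F e + F e ^ 2)) := by
    refine Ex_mono fun e _ => (le_of_eq ?_).trans ((sq_max_sub_le w (F e - M)).trans_eq (by ring))
    congr 2
    simp only [w]; ring
  have h2 : max w 0 ≤ max (c - x) 0 := max_le_max_right 0 (by simp only [w]; linarith)
  have h3 : max w 0 ^ 2 ≤ max (c - x) 0 ^ 2 := pow_le_pow_left₀ (le_max_right _ _) h2 2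
  rw [Ex_add, Ex_const, Ex_add, Ex_mul_left] at h1
  change _ ≤ _ + (_ * M + _) at h1
  nlinarith [sq_nonneg M]

variable {p : unitInterval} {b K : ℕ} {χ : ℕ → ℝ} {g : ℕ → ℕ → ℝ}

/-- Only walks of fewer than K steps and no longer than the depth of their start are counted. They
keep the base and lower the depth by exactly their length; all other contributions are nonnegative.
-/
lemma vertexSum_le_add_Ex (hp : 0 < (p : ℝ)) {a : ℕ} (ha : 0 < a) {m : ℕ} [NeZero m]
    (hχ : ∀ i, 0 ≤ χ i) {g₀ g₁ : ℕ → ℝ} (hg : ∀ d, 0 ≤ g₁ d)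
    (hsub : ∀ d, g₀ d ≤ g₁ d + (m : ℝ)⁻¹ * ∑ k ∈ Finset.range K,
      if k ≤ d then geom p k * g₁ (d - k + 1) else 0)
    {G : OutGraph 1 m} (hG : Recursive G) :
    vertexSum a G (fun i d => χ i * g₀ d) ≤ vertexSum a G (fun i d => χ i * g₁ d) +
      Ex (newHead p G) fun e => χ (base a G e) * g₁ (depth a G e + 1) := by
  have hp0 : p ≠ 0 := fun h => by simp [h] at hp
  refine le_trans ?_ (add_le_add_right (Ex_newHead_ge hp0 G
    (fun v => mul_nonneg (hχ _) (hg _)) K) _)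
  rw [vertexSum, vertexSum, Finset.mul_sum, ← Finset.sum_add_distrib]
  refine Finset.sum_le_sum fun u _ => ?_
  refine (mul_le_mul_of_nonneg_left (hsub _) (hχ _)).trans ?_
  rw [mul_add, mul_left_comm]
  refine add_le_add_right (mul_le_mul_of_nonneg_left ?_ (by positivity)) _
  rw [Finset.mul_sum]
  refine Finset.sum_le_sum fun k _ => ?_
  split_ifs with hk
  · rw [depth_iterate ha hG hk, base_iterate ha hG hk]
    exact le_of_eq (by ring)
  · rw [mul_zero]
    exact mul_nonneg (geom_nonneg hp.le p.2.2 k) (mul_nonneg (hχ _) (hg _))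

/-- Time is the number of vertices. At time b + 1 every relative depth is 0, so the sum equals its
target; afterwards each step adds at most the second moment of the new vertex's contribution. -/
theorem Ex_sq_max_sub_vertexSum_le (hp : 0 < (p : ℝ)) (hχ : ∀ i, 0 ≤ χ i) (hχ1 : ∀ i, χ i ≤ 1)
    (hg : ∀ t d, 0 ≤ g t d)
    (hsub : ∀ t, b + 1 ≤ t → ∀ d, g t d ≤ g (t + 1) d + (t : ℝ)⁻¹ * ∑ k ∈ Finset.range K,
      if k ≤ d then geom p k * g (t + 1) (d - k + 1) else 0)
    {V : ℕ → ℝ} (hV : ∀ n, b ≤ n → Ex (webgraph 1 p n) (fun G => Ex (newHead p G) fun e =>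
      g (n + 2) (depth (b + 1) G e + 1) ^ 2) ≤ V n) {n : ℕ} (hn : b ≤ n) :
    Ex (webgraph 1 p n) (fun G => max ((∑ i ∈ Finset.range (b + 1), χ i) * g (b + 1) 0 -
      vertexSum (b + 1) G fun i d => χ i * g (n + 1) d) 0 ^ 2) ≤ ∑ j ∈ Finset.Ico b n, V j := by
  induction n, hn using Nat.le_induction with
  | base =>
    have : ∀ G : OutGraph 1 (b + 1), vertexSum (b + 1) G (fun i d => χ i * g (b + 1) d) =
        (∑ i ∈ Finset.range (b + 1), χ i) * g (b + 1) 0 := by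
      intro G
      rw [vertexSum_of_le le_rfl, Finset.sum_mul,
        Finset.sum_range fun i => χ i * g (b + 1) 0]
    simp [this, Ex_const]
  | succ n hn ih =>
    rw [Finset.sum_Ico_succ_top hn, Ex_webgraph_succ]
    refine le_trans ?_ (add_le_add ih (hV n hn))
    rw [← Ex_add]
    refine Ex_mono fun G hG => ?_
    have hG' := recursive_of_mem_support hG
    simp only [vertexSum_addVertex (Nat.succ_pos b) (by omega : b + 1 ≤ n + 1) hG']
    refine (Ex_sq_max_sub_le _ _ (vertexSum_le_add_Ex hp (Nat.succ_pos b) hχ (hg (n + 1 + 1))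
      (hsub (n + 1) (by omega)) hG')).trans ?_
    gcongr
    refine Ex_mono fun e _ => ?_
    rw [mul_pow]
    exact mul_le_of_le_one_left (sq_nonneg _) (pow_le_one₀ (hχ _) (hχ1 _))

end LowerTail

/-! ### Distances in the tree -/

section Distance

variable {m : ℕ}

lemma adj_underlying {G : OutGraph 1 m} {u v : Fin m} :
    (underlying G).Adj u v ↔ u ≠ v ∧ (step G u = v ∨ step G v = u) := by
  rw [underlying, SimpleGraph.fromRel_adj]
  simp [step, Fin.exists_fin_one]

lemma adj_step {G : OutGraph 1 m} (hG : Recursive G) {v : Fin m} (hv : v.val ≠ 0) :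
    (underlying G).Adj v (step G v) := by
  refine adj_underlying.2 ⟨fun h => ?_, Or.inl rfl⟩
  have h1 := hG v
  rw [← h] at h1
  omega

lemma exists_walk_length_eq_depth {G : OutGraph 1 (m + 1)} (hG : Recursive G) (v : Fin (m + 1)) :
    ∃ q : (underlying G).Walk v 0, q.length = depth 1 G v := by
  induction hk : v.val using Nat.strong_induction_on generalizing v with
  | _ k ih =>
    by_cases hv : v.val = 0
    · obtain rfl : v = 0 := Fin.ext hv
      exact ⟨.nil, by rw [depth_of_lt (by simp)]; rfl⟩
    · obtain ⟨q, hq⟩ := ih _ (by have := hG v; omega) (step G v) rfl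
      refine ⟨.cons (adj_step hG hv) q, ?_⟩
      rw [SimpleGraph.Walk.length_cons, hq, (depth_step one_pos hG (v := v) (by omega)).1]

lemma connected_underlying {G : OutGraph 1 (m + 1)} (hG : Recursive G) :
    (underlying G).Connected := by
  refine ⟨fun u v => ?_⟩
  obtain ⟨q, -⟩ := exists_walk_length_eq_depth hG u
  obtain ⟨q', -⟩ := exists_walk_length_eq_depth hG v
  exact ⟨q.append q'.reverse⟩

lemma height_le {G : OutGraph 1 (m + 1)} (hG : Recursive G) {x : ℝ} (hx : 0 ≤ x)
    (h : ∀ v, (depth 1 G v : ℝ) ≤ x) : (height (underlying G) : ℝ) ≤ x := by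
  refine (Nat.le_floor_iff hx).1 (Finset.sup_le fun v _ => ?_)
  obtain ⟨q, hq⟩ := exists_walk_length_eq_depth hG v
  rw [SimpleGraph.dist_comm]
  exact (SimpleGraph.dist_le q).trans (hq.trans_le ((Nat.le_floor_iff hx).2 (h v)))

lemma diam_le_two_mul_height {n : ℕ} {T : SimpleGraph (Fin (n + 1))} (hT : T.Connected) :
    T.diam ≤ 2 * height T := by
  obtain ⟨u, v, huv⟩ := T.exists_dist_eq_diam
  rw [← huv]
  have h0 : ∀ w, T.dist 0 w ≤ height T := fun w =>
    Finset.le_sup (f := fun v => T.dist 0 v) (Finset.mem_univ w)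
  have h := hT.dist_triangle (u := u) (v := 0) (w := v)
  have h1 := h0 u
  have h2 := h0 v
  rw [SimpleGraph.dist_comm] at h1
  omega

lemma abs_sub_le_dist {V : Type*} {T : SimpleGraph V} (hT : T.Connected) {f : V → ℤ}
    (hf : ∀ u v, T.Adj u v → |f u - f v| ≤ 1) (u v : V) : |f u - f v| ≤ T.dist u v := by
  obtain ⟨q, hq⟩ := hT.exists_walk_length_eq_dist u v
  rw [← hq]
  clear hq
  induction q with
  | nil => simp
  | @cons x y z h q ih =>
    rw [SimpleGraph.Walk.length_cons]
    have := abs_sub_le (f x) (f y) (f z)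
    have := hf x y h
    push_cast
    linarith

/-- Count depth positively for bases below N and negatively for the others. This function vanishes
on the `a` oldest vertices, and every other edge preserves the base, so it is 1-Lipschitz on the
tree. -/
lemma depth_add_depth_le_diam {a : ℕ} (ha : 0 < a) {G : OutGraph 1 (m + 1)} (hG : Recursive G)
    {N : ℕ} {v w : Fin (m + 1)} (hv : base a G v < N) (hw : N ≤ base a G w) :
    depth a G v + depth a G w ≤ (underlying G).diam := by
  have hT := connected_underlying hG
  set f : Fin (m + 1) → ℤ := fun v => if base a G v < N then (depth a G v : ℤ) else -depth a G v
  have key : ∀ u, |f u - f (step G u)| ≤ 1 := by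
    intro u
    by_cases hu : u.val < a
    · have h1 : (step G u).val < a := by have := hG u; omega
      simp [f, depth_of_lt hu, depth_of_lt h1]
    · obtain ⟨h1, h2⟩ := depth_step ha hG (not_lt.1 hu)
      simp only [f, h1, h2]
      split_ifs <;> simp
  have h := abs_sub_le_dist hT (f := f) (fun u v huv => ?_) v w
  · simp only [f, if_pos hv, if_neg (not_lt.2 hw)] at h
    have h' : (underlying G).dist v w ≤ (underlying G).diam :=
      SimpleGraph.dist_le_diam (SimpleGraph.connected_iff_ediam_ne_top.1 hT)
    have := le_abs_self ((depth a G v : ℤ) - -(depth a G w : ℤ))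
    omega
  · rcases (adj_underlying.1 huv).2 with rfl | rfl
    · exact key u
    · rw [abs_sub_comm]; exact key v

end Distance

/-! ### Probabilities -/

section Probability

variable {α : Type*} [Fintype α]

open Classical in
/-- The probability of an event under a law on a finite type. -/
noncomputable def Pr (μ : PMF α) (q : α → Prop) : ℝ := Ex μ fun a => if q a then 1 else 0

lemma Pr_nonneg (μ : PMF α) (q : α → Prop) : 0 ≤ Pr μ q :=
  Ex_nonneg fun _ => by split_ifs <;> simp

lemma Pr_le_of_imp {μ : PMF α} {q q' : α → Prop} (h : ∀ a ∈ μ.support, q a → q' a) :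
    Pr μ q ≤ Pr μ q' :=
  Ex_mono fun a ha => by have := h a ha; split_ifs <;> simp_all

lemma Pr_or_le (μ : PMF α) (q q' : α → Prop) : Pr μ (fun a => q a ∨ q' a) ≤ Pr μ q + Pr μ q' := by
  rw [Pr, Pr, Pr, ← Ex_add]
  exact Ex_mono fun a _ => by split_ifs <;> simp_all

lemma mul_Pr_le {μ : PMF α} {q : α → Prop} {F : α → ℝ} {c : ℝ} (hF : ∀ a, 0 ≤ F a)
    (h : ∀ a ∈ μ.support, q a → c ≤ F a) : c * Pr μ q ≤ Ex μ F := by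
  rw [Pr, ← Ex_mul_left]
  refine Ex_mono fun a ha => ?_
  split_ifs with hq
  · simpa using h a ha hq
  · simpa using hF a

lemma toOuterMeasure_eq (μ : PMF α) (q : α → Prop) :
    μ.toOuterMeasure {a | q a} = ENNReal.ofReal (1 - Pr μ fun a => ¬ q a) := by
  classical
  have h : 1 - Pr μ (fun a => ¬ q a) = Pr μ q := by
    have : Pr μ q + Pr μ (fun a => ¬ q a) = 1 := by
      rw [Pr, Pr, ← Ex_add]
      convert Ex_const μ 1 using 2
      ext a
      by_cases hq : q a <;> simp [hq]
    linarith
  rw [h, PMF.toOuterMeasure_apply_fintype, Pr, Ex,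
    ENNReal.ofReal_sum_of_nonneg fun a _ => mul_nonneg ENNReal.toReal_nonneg (by split_ifs <;> simp)]
  refine Finset.sum_congr rfl fun a _ => ?_
  by_cases hq : q a
  · simp [hq, ENNReal.ofReal_toReal (μ.apply_ne_top a)]
  · simp [hq]

end Probability

lemma tendsto_toOuterMeasure_tree {p : unitInterval}
    (q : (n : ℕ) → SimpleGraph (Fin (n + 1)) → Prop)
    (h : ∀ δ : ℝ, 0 < δ → ∀ᶠ n in atTop,
      Pr (webgraph 1 p n) (fun G => ¬ q n (underlying G)) ≤ δ) :
    Tendsto (fun n => (tree p n).toOuterMeasure {T | q n T}) atTop (𝓝 1) := by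
  have h0 : Tendsto (fun n => Pr (webgraph 1 p n) (fun G => ¬ q n (underlying G))) atTop (𝓝 0) := by
    rw [Metric.tendsto_nhds]
    intro ε hε
    filter_upwards [h (ε / 2) (by positivity)] with n hn
    rw [Real.dist_0_eq_abs, abs_of_nonneg (Pr_nonneg _ _)]
    linarith
  have h1 := ENNReal.tendsto_ofReal (tendsto_const_nhds (x := (1 : ℝ)).sub h0)
  rw [sub_zero, ENNReal.ofReal_one] at h1
  refine h1.congr fun n => ?_
  rw [tree, PMF.toOuterMeasure_map_apply, Set.preimage_ofPred_eq,
    toOuterMeasure_eq _ fun G => q n (underlying G)]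

/-- Concentration of height and diameter follows from an upper bound on all depths and a lower
bound on the diameter. -/
theorem aasAsymptotic_of_bounds {p : unitInterval} {c : ℝ} (hc : 0 < c)
    (hU : ∀ ε : ℝ, 0 < ε → ∀ δ : ℝ, 0 < δ → ∀ᶠ n : ℕ in atTop, Pr (webgraph 1 p n)
      (fun G => ∃ v, (c + ε) * Real.log ((n + 1 : ℕ) : ℝ) < depth 1 G v) ≤ δ)
    (hL : ∀ ε : ℝ, 0 < ε → ∀ δ : ℝ, 0 < δ → ∀ᶠ n : ℕ in atTop, Pr (webgraph 1 p n)
      (fun G => ((underlying G).diam : ℝ) < 2 * (c - ε) * Real.log ((n + 1 : ℕ) : ℝ)) ≤ δ) :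
    AasAsymptotic (tree p) (fun _ T => height T) (fun n => c * Real.log ((n + 1 : ℕ) : ℝ)) ∧
      AasAsymptotic (tree p) (fun _ T => T.diam)
        (fun n => 2 * c * Real.log ((n + 1 : ℕ) : ℝ)) := by
  have key : ∀ ε : ℝ, 0 < ε → ∀ δ : ℝ, 0 < δ → ∀ᶠ n : ℕ in atTop, Pr (webgraph 1 p n)
      (fun G => ¬ ((height (underlying G) : ℝ) ≤ (c + ε * c) * Real.log ((n + 1 : ℕ) : ℝ) ∧
        2 * (c - ε * c) * Real.log ((n + 1 : ℕ) : ℝ) ≤ (underlying G).diam)) ≤ δ := by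
    intro ε hε δ hδ
    filter_upwards [hU (ε * c) (by positivity) (δ / 2) (by positivity),
      hL (ε * c) (by positivity) (δ / 2) (by positivity)] with n h1 h2
    refine (Pr_le_of_imp (fun G hG h => ?_)).trans ((Pr_or_le _ _ _).trans
      ((add_le_add h1 h2).trans_eq (by ring)))
    by_contra! h3
    refine h ⟨height_le (recursive_of_mem_support hG) ?_ h3.1, h3.2⟩
    have : 0 ≤ Real.log ((n + 1 : ℕ) : ℝ) := Real.log_natCast_nonneg _
    positivity
  have hlog : ∀ n : ℕ, 0 ≤ Real.log ((n + 1 : ℕ) : ℝ) := fun n => Real.log_natCast_nonneg _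
  constructor
  · intro ε hε
    refine tendsto_toOuterMeasure_tree _ fun δ hδ => ?_
    filter_upwards [key ε hε δ hδ] with n hn
    refine (Pr_le_of_imp (fun G hG h h' => h ?_)).trans hn
    have h2 : ((underlying G).diam : ℝ) ≤ 2 * height (underlying G) := by
      exact_mod_cast diam_le_two_mul_height (connected_underlying (recursive_of_mem_support hG))
    rw [abs_of_nonneg (mul_nonneg hc.le (hlog n)), abs_le]
    constructor <;> linarith
  · intro ε hε
    refine tendsto_toOuterMeasure_tree _ fun δ hδ => ?_
    filter_upwards [key ε hε δ hδ] with n hn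
    refine (Pr_le_of_imp (fun G hG h h' => h ?_)).trans hn
    have h2 : ((underlying G).diam : ℝ) ≤ 2 * height (underlying G) := by
      exact_mod_cast diam_le_two_mul_height (connected_underlying (recursive_of_mem_support hG))
    rw [abs_of_nonneg (mul_nonneg (by positivity) (hlog n)), abs_le]
    constructor <;> linarith

/-! ### The threshold and the function `s` -/

theorem existsUnique_isThreshold : ∃! q : ℝ, IsThreshold q := by
  set f : ℝ → ℝ := fun q => Real.log ((1 - q) / q) - (1 - q) / (1 - 2 * q) with hf
  have hiff : ∀ q, IsThreshold q ↔ q ∈ Set.Ioo (0 : ℝ) (1 / 2) ∧ f q = 0 := fun q => by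
    simp only [IsThreshold, hf, sub_eq_zero]
  have hanti : StrictAntiOn f (Set.Ioo 0 (1 / 2)) := by
    rintro x ⟨hx0, hx1⟩ y ⟨hy0, hy1⟩ hxy
    have h1 : (1 - y) / y < (1 - x) / x := by
      rw [div_lt_div_iff₀ hy0 hx0]; nlinarith
    have h2 : Real.log ((1 - y) / y) < Real.log ((1 - x) / x) :=
      Real.log_lt_log (div_pos (by linarith) hy0) h1
    have h3 : (1 - x) / (1 - 2 * x) ≤ (1 - y) / (1 - 2 * y) := by
      rw [div_le_div_iff₀ (by linarith) (by linarith)]; nlinarith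
    simp only [hf]; linarith
  -- The endpoints work because log 9 ≥ 9/8 and log(3/2) ≤ 3.
  have hcont : ContinuousOn f (Set.Icc (1 / 10) (2 / 5)) := by
    intro x hx
    obtain ⟨h1, h2⟩ := hx
    refine ContinuousAt.continuousWithinAt (ContinuousAt.sub (ContinuousAt.log
      (ContinuousAt.div₀ (by fun_prop) (by fun_prop) (by linarith)) ?_)
      (ContinuousAt.div₀ (by fun_prop) (by fun_prop) (by linarith)))
    exact (div_pos (by linarith) (by linarith)).ne'
  have hlow : f (2 / 5) ≤ 0 := by
    have := Real.log_le_sub_one_of_pos (show (0 : ℝ) < (1 - 2 / 5) / (2 / 5) by norm_num)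
    simp only [hf]; norm_num at this ⊢; linarith
  have hhigh : 0 ≤ f (1 / 10) := by
    have h2 := Real.log_two_gt_d9
    have h3 : Real.log ((2 : ℝ) ^ 3) ≤ Real.log ((1 - 1 / 10) / (1 / 10)) :=
      Real.log_le_log (by norm_num) (by norm_num)
    rw [Real.log_pow] at h3
    simp only [hf]; norm_num at h3 ⊢; linarith
  obtain ⟨q, hq, hq0⟩ := intermediate_value_Icc' (by norm_num) hcont ⟨hlow, hhigh⟩
  have hq' : q ∈ Set.Ioo (0 : ℝ) (1 / 2) := ⟨by linarith [hq.1], by linarith [hq.2]⟩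
  refine ⟨q, (hiff q).2 ⟨hq', hq0⟩, fun y hy => ?_⟩
  obtain ⟨hy1, hy2⟩ := (hiff y).1 hy
  exact hanti.injOn hy1 hq' (hy2.trans hq0.symm)

lemma log_lt_log_of_lt {p x y : ℝ} (hp : p < 1) (hx : 0 ≤ x) (hxy : x < y) (hy : y < 1) :
    Real.log ((1 - p) * (2 - x) / (1 - x)) < Real.log ((1 - p) * (2 - y) / (1 - y)) := by
  have hr : 0 < 1 - p := by linarith
  refine Real.log_lt_log (div_pos (mul_pos hr (by linarith)) (by linarith)) ?_
  rw [div_lt_div_iff₀ (by linarith) (by linarith)]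
  nlinarith

lemma IsS.log_eq {p s : ℝ} (h : IsS p s) : Real.log ((1 - p) * (2 - s) / (1 - s)) = 1 / s :=
  eq_one_div_of_mul_eq_one_right h.2

theorem existsUnique_isS {p : ℝ} (hp0 : 0 < p) (hp : p < 1) : ∃! s : ℝ, IsS p s := by
  -- At a solution an increasing logarithm equals the decreasing function 1/s.
  have huniq : ∀ x y, IsS p x → IsS p y → ¬ x < y := by
    intro x y hx hy hxy
    have h := log_lt_log_of_lt hp hx.1.1.le hxy hy.1.2
    rw [hx.log_eq, hy.log_eq] at h
    exact absurd (one_div_lt_one_div_of_lt hx.1.1 hxy) h.not_gt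
  -- With this y the argument of the logarithm is (2 - y) exp 2 ≥ exp 2, and y > 1/2.
  set y := 1 - (1 - p) * Real.exp (-2) with hy
  have he : Real.exp (-2) < 1 / 2 := by
    have h1 := Real.add_one_lt_exp (x := 2) (by norm_num)
    rw [Real.exp_neg, ← one_div]
    exact one_div_lt_one_div_of_lt (by norm_num) (by linarith)
  have he0 := Real.exp_pos (-2)
  have hy1 : y < 1 := by nlinarith
  have hy0 : 1 / 2 < y := by nlinarith
  have hcont : ContinuousOn (fun s => s * Real.log ((1 - p) * (2 - s) / (1 - s)))
      (Set.Icc 0 y) := by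
    intro s hs
    have h1 : s < 1 := hs.2.trans_lt hy1
    refine ContinuousAt.continuousWithinAt (continuousAt_id.mul (ContinuousAt.log
      (ContinuousAt.div₀ (by fun_prop) (by fun_prop) (by linarith)) ?_))
    exact (div_pos (mul_pos (by linarith) (by linarith)) (by linarith)).ne'
  have hhigh : 1 ≤ y * Real.log ((1 - p) * (2 - y) / (1 - y)) := by
    have h1 : Real.exp 2 ≤ (1 - p) * (2 - y) / (1 - y) := by
      rw [show 1 - y = (1 - p) * Real.exp (-2) by rw [hy]; ring, Real.exp_neg]
      have hr : 0 < 1 - p := by linarith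
      rw [le_div_iff₀ (by positivity), mul_comm (1 - p), ← mul_assoc,
        mul_inv_cancel₀ (Real.exp_pos 2).ne']
      nlinarith
    have h2 := Real.log_le_log (Real.exp_pos 2) h1
    rw [Real.log_exp] at h2
    nlinarith
  obtain ⟨s, hs, hs1⟩ := intermediate_value_Icc (by linarith) hcont
    ⟨(by simp : (0 : ℝ) * _ ≤ 1), hhigh⟩
  have hs' : IsS p s := by
    refine ⟨⟨lt_of_le_of_ne hs.1 ?_, hs.2.trans_lt hy1⟩, hs1⟩
    rintro rfl
    simp at hs1
  exact ⟨s, hs', fun x hx => le_antisymm (not_lt.1 (huniq s x hs' hx)) (not_lt.1 (huniq x s hx hs'))⟩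

/-! ### The optimal exponent -/

section Optimal

variable {p s : ℝ}

lemma IsS.exp_eq (hp : p < 1) (h : IsS p s) : Real.exp (1 / s) = (1 - p) * (2 - s) / (1 - s) := by
  rw [← h.log_eq, Real.exp_log]
  exact div_pos (mul_pos (by linarith) (by linarith [h.1.2])) (by linarith [h.1.2])

lemma IsS.mul_exp_neg (hp : p < 1) (h : IsS p s) :
    (1 - p) * Real.exp (-(1 / s)) = (1 - s) / (2 - s) := by
  have h1 : 0 < 1 - s := by linarith [h.1.2]
  have h2 : 0 < 2 - s := by linarith
  have h3 : 0 < 1 - p := by linarith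
  rw [Real.exp_neg, h.exp_eq hp]
  field_simp

lemma IsS.growth_eq (hp : p < 1) (h : IsS p s) :
    growth p (1 / s) = p * Real.exp (1 / s) * (2 - s) := by
  have h2 : 0 < 2 - s := by linarith [h.1.2]
  rw [growth, h.mul_exp_neg hp, show 1 - (1 - s) / (2 - s) = 1 / (2 - s) by field_simp; ring]
  field_simp

/-- With `IsS.growthDeriv_eq` this is the tangency: the tangent to `growth p` at 1/s passes through
the origin with slope `cL p s`. -/
lemma IsS.growth_eq_mul (hp : p < 1) (h : IsS p s) : growth p (1 / s) = 1 / s * cL p s := by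
  rw [h.growth_eq hp, cL]
  have := h.1.1
  field_simp

lemma IsS.cL_pos (hp : 0 < p) (h : IsS p s) : 0 < cL p s := by
  have h1 := h.1.1
  have h2 : 0 < 2 - s := by linarith [h.1.2]
  rw [cL]
  positivity

theorem one_le_growth {p₀ : ℝ} (h₀ : IsThreshold p₀) (hp0 : p₀ ≤ p) (hp : p < 1) (h : IsS p s) :
    1 ≤ growth p (1 / s) := by
  obtain ⟨⟨h1, h2⟩, h3⟩ := h₀
  obtain ⟨⟨hs0, hs1⟩, hs⟩ := id h
  rw [h.growth_eq hp, h.exp_eq hp]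
  have hs2 : 0 < 1 - s := by linarith
  rw [mul_div_assoc', div_mul_eq_mul_div, one_le_div hs2]
  -- If s were below x = (1 - 2p)/(1 - p), monotonicity in s would give 1/s < log((1 - p)/p).
  -- Comparison with p₀ bounds that logarithm by 1/x < 1/s.
  have hlow : 1 - 2 * p ≤ s * (1 - p) := by
    by_contra! hlt
    have hp2 : p < 1 / 2 := by nlinarith
    set x := (1 - 2 * p) / (1 - p) with hx
    have hsx : s < x := by rw [hx, lt_div_iff₀ (by linarith)]; exact hlt
    have hx1 : x < 1 := by rw [hx, div_lt_one (by linarith)]; linarith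
    have h4 := log_lt_log_of_lt hp hs0.le hsx hx1
    have h5 : (1 - p) * (2 - x) / (1 - x) = (1 - p) / p := by
      have : 1 - p ≠ 0 := by linarith
      have : p ≠ 0 := by linarith
      have h6 : 1 - x = p / (1 - p) := by rw [hx]; field_simp; ring
      have h7 : 2 - x = 1 / (1 - p) := by rw [hx]; field_simp; ring
      rw [h6, h7]; field_simp
    rw [h.log_eq, h5] at h4
    have h6 : Real.log ((1 - p) / p) ≤ Real.log ((1 - p₀) / p₀) := by
      refine Real.log_le_log (div_pos (by linarith) (by linarith)) ?_
      rw [div_le_div_iff₀ (by linarith) h1]; nlinarith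
    have h7 : (1 - p₀) / (1 - 2 * p₀) ≤ 1 / x := by
      rw [hx, one_div_div, div_le_div_iff₀ (by linarith) (by linarith)]; nlinarith
    have h8 := one_div_lt_one_div_of_lt hs0 hsx
    linarith
  have hexp : 1 < (1 - p) * (2 - s) / (1 - s) := by
    rw [← h.exp_eq hp]; exact Real.one_lt_exp_iff.2 (by positivity)
  rw [one_lt_div hs2] at hexp
  -- With A = (1 - p)(2 - s) and B = p(2 - s), the claim is AB - (A + B - 1) = (A - 1)(B - 1) ≥ 0;
  -- here A ≤ 1 by `hlow` and B < 1 by `hexp`.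
  nlinarith [mul_nonneg (sub_nonneg.2 hlow) (sub_nonneg.2 hexp.le)]

end Optimal

/-! ### Choice of the parameters of the test function -/

/-- The derivative of `growth p`. -/
noncomputable def growthDeriv (p l : ℝ) : ℝ :=
  p * Real.exp l * (1 - 2 * ((1 - p) * Real.exp (-l))) / (1 - (1 - p) * Real.exp (-l)) ^ 2

/-- The derivative of `growthDeriv p`. -/
noncomputable def growthDeriv₂ (p l : ℝ) : ℝ :=
  p * Real.exp l * (1 - 3 * ((1 - p) * Real.exp (-l)) + 4 * ((1 - p) * Real.exp (-l)) ^ 2) /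
    (1 - (1 - p) * Real.exp (-l)) ^ 3

section Parameters

variable {p l : ℝ}

lemma hasDerivAt_mul_exp_neg (r l : ℝ) :
    HasDerivAt (fun x => r * Real.exp (-x)) (-(r * Real.exp (-l))) l := by
  have h := ((hasDerivAt_neg l).exp).const_mul r
  exact h.congr_deriv (by ring)

lemma hasDerivAt_growth (hp : 0 < p) (hl : 0 ≤ l) :
    HasDerivAt (growth p) (growthDeriv p l) l := by
  have hq : 1 - (1 - p) * Real.exp (-l) ≠ 0 := by linarith [mul_exp_neg_lt_one hp hl]
  have h := ((Real.hasDerivAt_exp l).const_mul p).div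
    ((hasDerivAt_mul_exp_neg (1 - p) l).const_sub 1) hq
  refine h.congr_deriv ?_
  rw [growthDeriv]
  ring

lemma hasDerivAt_growthDeriv (hp : 0 < p) (hl : 0 ≤ l) :
    HasDerivAt (growthDeriv p) (growthDeriv₂ p l) l := by
  have hq : 1 - (1 - p) * Real.exp (-l) ≠ 0 := by linarith [mul_exp_neg_lt_one hp hl]
  have hd := hasDerivAt_mul_exp_neg (1 - p) l
  have h := (((Real.hasDerivAt_exp l).const_mul p).mul ((hd.const_mul 2).const_sub 1)).div
    ((hd.const_sub 1).pow 2) (pow_ne_zero 2 hq)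
  refine h.congr_deriv ?_
  simp only [growthDeriv₂, Pi.mul_apply, Pi.pow_apply]
  generalize (1 - p) * Real.exp (-l) = q at hq ⊢
  field_simp
  ring

lemma growthDeriv₂_pos (hp : 0 < p) (hl : 0 ≤ l) : 0 < growthDeriv₂ p l := by
  have hq : 0 < 1 - (1 - p) * Real.exp (-l) := by linarith [mul_exp_neg_lt_one hp hl]
  refine div_pos (mul_pos (mul_pos hp (Real.exp_pos l)) ?_) (pow_pos hq 3)
  -- 1 - 3q + 4q² = (2q - 3/4)² + 7/16.
  nlinarith [sq_nonneg (2 * ((1 - p) * Real.exp (-l)) - 3 / 4)]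

lemma hasSum_geom_mul_exp_mul (hp : 0 < p) (hp1 : p ≤ 1) (hl : 0 ≤ l) :
    HasSum (fun k : ℕ => geom p k * Real.exp (l * (1 - k)) * (1 - k)) (growthDeriv p l) := by
  have hq := mul_exp_neg_lt_one hp hl
  have hq0 : 0 ≤ (1 - p) * Real.exp (-l) := mul_nonneg (by linarith) (Real.exp_pos _).le
  have h := ((hasSum_geometric_of_lt_one hq0 hq).sub (hasSum_coe_mul_geometric_of_norm_lt_one
    (by rwa [Real.norm_of_nonneg hq0]))).mul_left (p * Real.exp l)
  have hne : 1 - (1 - p) * Real.exp (-l) ≠ 0 := by linarith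
  have hval : p * Real.exp l * ((1 - (1 - p) * Real.exp (-l))⁻¹ -
      (1 - p) * Real.exp (-l) / (1 - (1 - p) * Real.exp (-l)) ^ 2) = growthDeriv p l := by
    rw [growthDeriv]
    generalize (1 - p) * Real.exp (-l) = q at hne ⊢
    field_simp
    ring
  rw [hval] at h
  refine (congrArg (fun f => HasSum f (growthDeriv p l)) (funext fun k => ?_)).mpr h
  rw [geom, mul_pow, ← Real.exp_nat_mul, show l * (1 - k) = l + k * -l by ring, Real.exp_add]
  ring

lemma IsS.growthDeriv_eq {s : ℝ} (hp : p < 1) (h : IsS p s) :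
    growthDeriv p (1 / s) = cL p s := by
  have h2 : 0 < 2 - s := by linarith [h.1.2]
  rw [growthDeriv, h.mul_exp_neg hp, cL,
    show 1 - (1 - s) / (2 - s) = 1 / (2 - s) by field_simp; ring,
    show 1 - 2 * ((1 - s) / (2 - s)) = s / (2 - s) by field_simp; ring]
  field_simp

/-- Real part of the truncated complex exponential moment at `l + i w`. -/
noncomputable def reMoment (p l w : ℝ) (K : ℕ) : ℝ :=
  ∑ k ∈ Finset.range K, geom p k * Real.exp (l * (1 - k)) * Real.cos (w * (1 - k))

/-- Imaginary part of the truncated complex exponential moment at `l + i w`. -/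
noncomputable def imMoment (p l w : ℝ) (K : ℕ) : ℝ :=
  ∑ k ∈ Finset.range K, geom p k * Real.exp (l * (1 - k)) * Real.sin (w * (1 - k))

lemma tendsto_reMoment (p l : ℝ) (K : ℕ) : Tendsto (fun w => reMoment p l w K) (𝓝[>] 0)
    (𝓝 (∑ k ∈ Finset.range K, geom p k * Real.exp (l * (1 - k)))) := by
  have h : Continuous fun w => reMoment p l w K := by unfold reMoment; fun_prop
  have := h.tendsto 0
  simp only [reMoment, zero_mul, Real.cos_zero, mul_one] at this
  exact this.mono_left nhdsWithin_le_nhds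

lemma tendsto_imMoment_div (p l : ℝ) (K : ℕ) : Tendsto (fun w => imMoment p l w K / w) (𝓝[>] 0)
    (𝓝 (∑ k ∈ Finset.range K, geom p k * Real.exp (l * (1 - k)) * (1 - k))) := by
  have h : HasDerivAt (fun w => imMoment p l w K)
      (∑ k ∈ Finset.range K, geom p k * Real.exp (l * (1 - k)) * (1 - k)) 0 := by
    refine HasDerivAt.fun_sum fun k _ => ?_
    have := (((hasDerivAt_id (0 : ℝ)).mul_const (1 - k : ℝ)).sin).const_mul
      (geom p k * Real.exp (l * (1 - k)))
    simpa using this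
  have h1 := h.tendsto_slope_zero_right
  refine h1.congr fun w => ?_
  simp [imMoment, div_eq_inv_mul]

/-- The last inequality makes the second moments of the bump summable. In the limit of large K and
small w, x and y/w become φ(l) and φ'(l), and for η = 0 its two sides differ by F(l). This F
vanishes at L with slope -L φ''(L) < 0, so some l just below L works; K and then w are chosen
afterwards. -/
theorem exists_parameters {s : ℝ} (hp0 : 0 < p) (hp : p < 1) (h : IsS p s) {ε : ℝ} (hε : 0 < ε) :
    ∃ (l η w : ℝ) (K : ℕ), 0 < l ∧ 1 / s ≤ 2 * l ∧ 0 < η ∧ 0 < w ∧ w * K ≤ Real.pi / 2 ∧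
      0 < reMoment p l w K ∧ 0 < imMoment p l w K ∧ cL p s - ε < imMoment p l w K / w ∧
      growth p (1 / s) + η - 1 / s * (imMoment p l w K / w) <
        2 * (reMoment p l w K - l * (imMoment p l w K / w)) := by
  have hc := h.cL_pos hp0
  have hL : 0 < 1 / s := one_div_pos.2 h.1.1
  have hgL := h.growth_eq_mul hp
  have hdL := h.growthDeriv_eq hp
  set L := 1 / s
  set c := cL p s
  -- the exponent
  set F : ℝ → ℝ := fun l => 2 * (growth p l - l * growthDeriv p l) - L * (c - growthDeriv p l)
  have hF : HasDerivAt F (-(L * growthDeriv₂ p L)) L := by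
    have h1 := hasDerivAt_growth hp0 hL.le
    have h2 := hasDerivAt_growthDeriv hp0 hL.le
    have h3 := ((h1.sub ((hasDerivAt_id L).mul h2)).const_mul 2).sub ((h2.const_sub c).const_mul L)
    refine h3.congr_deriv ?_
    simp only [id]
    ring
  have hF0 : F L = 0 := by simp only [F, hdL, hgL]; ring
  have hFpos : ∀ᶠ l in 𝓝[<] L, 0 < F l := by
    have h1 := (hasDerivAt_iff_tendsto_slope.1 hF).mono_left
      (nhdsWithin_mono L fun x (hx : x < L) => hx.ne)
    have h2 : -(L * growthDeriv₂ p L) < 0 := by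
      have := mul_pos hL (growthDeriv₂_pos hp0 hL.le)
      linarith
    filter_upwards [h1.eventually (gt_mem_nhds h2), self_mem_nhdsWithin] with l hl1 hl2
    rw [slope_def_field, hF0, sub_zero] at hl1
    by_contra! h3
    exact absurd hl1 (not_lt.2 (div_nonneg_of_nonpos h3 (sub_nonpos.2 (le_of_lt hl2))))
  have hdc := (hasDerivAt_growthDeriv hp0 hL.le).continuousAt.tendsto
  rw [hdL] at hdc
  obtain ⟨l, ⟨⟨hFl, hl1⟩, hl2⟩, hl3⟩ := (((hFpos.and
    ((hdc.eventually (lt_mem_nhds (sub_lt_self c hε))).filter_mono nhdsWithin_le_nhds)).and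
    ((hdc.eventually (lt_mem_nhds hc)).filter_mono nhdsWithin_le_nhds)).and
    ((lt_mem_nhds (half_lt_self hL)).filter_mono nhdsWithin_le_nhds)).exists
  have hl : 0 < l := by linarith
  -- the truncation
  have hK1 := (hasSum_geom_mul_exp hp0 hp.le hl.le).tendsto_sum_nat
  have hK2 := (hasSum_geom_mul_exp_mul hp0 hp.le hl.le).tendsto_sum_nat
  have hgap : growth p L - L * growthDeriv p l < 2 * (growth p l - l * growthDeriv p l) := by
    simp only [F] at hFl; rw [hgL]; linarith
  have hK3 := ((hK2.const_mul L).const_sub (growth p L)).eventually_lt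
    ((hK1.sub (hK2.const_mul l)).const_mul 2) hgap
  obtain ⟨K, ⟨⟨hKgap, hKd⟩, hKc⟩, hKpos⟩ := (((hK3.and
    (hK2.eventually (lt_mem_nhds hl2))).and (hK2.eventually (lt_mem_nhds hl1))).and
    (hK1.eventually (lt_mem_nhds (growth_pos hp0 hl.le)))).exists
  -- the frequency
  have hw1 := tendsto_reMoment p l K
  have hw2 := tendsto_imMoment_div p l K
  have hw3 := ((hw2.const_mul L).const_sub (growth p L)).eventually_lt
    ((hw1.sub (hw2.const_mul l)).const_mul 2) hKgap
  have hw4 : ∀ᶠ w : ℝ in 𝓝[>] 0, w * K ≤ Real.pi / 2 := by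
    have : Tendsto (fun w : ℝ => w * K) (𝓝 0) (𝓝 (0 * K)) := tendsto_id.mul_const _
    rw [zero_mul] at this
    exact ((this.eventually (gt_mem_nhds (half_pos Real.pi_pos))).mono fun w hw => hw.le).filter_mono
      nhdsWithin_le_nhds
  obtain ⟨w, ⟨⟨⟨⟨hwgap, hwd⟩, hwc⟩, hwpos⟩, hwK⟩, hw0⟩ := (((((hw3.and
    (hw2.eventually (lt_mem_nhds hKd))).and (hw2.eventually (lt_mem_nhds hKc))).and
    (hw1.eventually (lt_mem_nhds hKpos))).and hw4).and self_mem_nhdsWithin).exists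
  have hw0' : 0 < w := hw0
  -- η is half of the gap that is left.
  refine ⟨l, (2 * (reMoment p l w K - l * (imMoment p l w K / w)) -
    (growth p L - L * (imMoment p l w K / w))) / 2, w, K, hl, by linarith, by linarith, hw0', hwK,
    hwpos, ?_, hwc, by linarith⟩
  have := mul_pos hwd hw0'
  rwa [div_mul_cancel₀ _ hw0'.ne'] at this

end Parameters

/-! ### The travelling sine bump -/

/-- The function `exp (l d) sin (w d - θ)` restricted to the half-period `0 < w d - θ < π`. -/
noncomputable def bump (l w θ : ℝ) (d : ℕ) : ℝ :=
  if 0 < w * d - θ ∧ w * d - θ < Real.pi then Real.exp (l * d) * Real.sin (w * d - θ) else 0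

/-- The angle by which the bump moves at time `t`. -/
noncomputable def angle (x y t : ℝ) : ℝ := Real.arctan (y / (t + x))

/-- The factor by which the bump grows at time `t`. -/
noncomputable def modulus (x y t : ℝ) : ℝ := (1 + x / t) * √(1 + (y / (t + x)) ^ 2)

section Bump

variable {l w θ x y t : ℝ}

lemma bump_nonneg (l w θ : ℝ) (d : ℕ) : 0 ≤ bump l w θ d := by
  rw [bump]
  split_ifs with h
  · exact mul_nonneg (Real.exp_pos _).le (Real.sin_pos_of_pos_of_lt_pi h.1 h.2).le
  · rfl

/-- On the half-periods next to the support the sine is nonpositive, so cutting it off there only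
increases the function. -/
lemma le_bump {d : ℕ} (h1 : -Real.pi ≤ w * d - θ) (h2 : w * d - θ ≤ 2 * Real.pi) :
    Real.exp (l * d) * Real.sin (w * d - θ) ≤ bump l w θ d := by
  rw [bump]
  split_ifs with h
  · rfl
  · refine mul_nonpos_of_nonneg_of_nonpos (Real.exp_pos _).le ?_
    rcases le_or_gt (w * d - θ) 0 with h0 | h0
    · exact Real.sin_nonpos_of_nonpos_of_neg_pi_le h0 h1
    · have h3 : Real.pi ≤ w * d - θ := by by_contra! h3; exact h ⟨h0, h3⟩
      have := Real.sin_nonneg_of_nonneg_of_le_pi (x := w * d - θ - Real.pi) (by linarith)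
        (by linarith)
      rw [Real.sin_sub_pi] at this
      linarith

/-- On the support d ≤ (θ + π)/w, so the part 2l - L ≥ 0 of the exponent can be replaced by its
value at the right end, leaving the controlled moment at L. -/
lemma bump_sq_le (hw : 0 < w) {L : ℝ} (hL : L ≤ 2 * l) (d : ℕ) :
    bump l w θ d ^ 2 ≤ Real.exp ((2 * l - L) * ((θ + Real.pi) / w)) * Real.exp (L * d) := by
  rw [bump]
  split_ifs with h
  · rw [mul_pow, ← Real.exp_nat_mul, ← Real.exp_add]
    have hd : (d : ℝ) ≤ (θ + Real.pi) / w := by rw [le_div_iff₀ hw]; linarith [h.2]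
    have h1 : (2 * l - L) * d ≤ (2 * l - L) * ((θ + Real.pi) / w) :=
      mul_le_mul_of_nonneg_left hd (by linarith)
    calc _ ≤ Real.exp ((2 : ℕ) * (l * d)) * 1 :=
          mul_le_mul_of_nonneg_left (Real.sin_sq_le_one _) (Real.exp_pos _).le
      _ ≤ _ := by
          rw [mul_one]
          refine Real.exp_le_exp.2 ?_
          push_cast
          linarith
  · rw [zero_pow two_ne_zero]; positivity

/-- With `modulus_mul_sin`: for x, t > 0, `modulus` and `angle` are the polar coordinates of 1 + (x
+ iy)/t. -/
lemma modulus_mul_cos (x y t : ℝ) : modulus x y t * Real.cos (angle x y t) = 1 + x / t := by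
  have : 0 < √(1 + (y / (t + x)) ^ 2) := Real.sqrt_pos.2 (by positivity)
  rw [modulus, angle, Real.cos_arctan]
  field_simp

lemma modulus_mul_sin (hx : 0 < x) (ht : 0 < t) :
    modulus x y t * Real.sin (angle x y t) = y / t := by
  have : 0 < √(1 + (y / (t + x)) ^ 2) := Real.sqrt_pos.2 (by positivity)
  rw [modulus, angle, Real.sin_arctan]
  field_simp

lemma le_modulus (hx : 0 < x) (ht : 0 < t) : 1 + x / t ≤ modulus x y t :=
  le_mul_of_one_le_right (by positivity)
    (Real.one_le_sqrt.2 (le_add_of_nonneg_right (sq_nonneg _)))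

lemma angle_nonneg (hx : 0 < x) (hy : 0 < y) (ht : 0 < t) : 0 ≤ angle x y t :=
  Real.arctan_nonneg.2 (by positivity)

lemma angle_le (hx : 0 < x) (hy : 0 < y) (ht : 0 < t) : angle x y t ≤ y / t := by
  have h : angle x y t ≤ y / (t + x) := by
    have h0 : 0 ≤ y / (t + x) := by positivity
    have h1 := Real.le_tan (angle_nonneg hx hy ht) (Real.arctan_lt_pi_div_two _)
    rwa [angle, Real.tan_arctan] at h1
  exact h.trans (div_le_div_of_nonneg_left hy.le ht (by linarith))

/-- The bump, moved and rescaled, is a subsolution of the recursion for expected vertex sums. -/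
theorem modulus_mul_bump_le {p : ℝ} (hp0 : 0 < p) (hp1 : p ≤ 1) {K : ℕ} (hw : 0 < w)
    (hwK : w * K ≤ Real.pi / 2) (hx : 0 < reMoment p l w K) (hy : 0 < imMoment p l w K)
    (hθ : 0 ≤ θ) (ht : 0 < t) (d : ℕ) :
    modulus (reMoment p l w K) (imMoment p l w K) t * bump l w θ d ≤
      bump l w (θ + angle (reMoment p l w K) (imMoment p l w K) t) d +
        t⁻¹ * ∑ k ∈ Finset.range K, if k ≤ d then geom p k *
          bump l w (θ + angle (reMoment p l w K) (imMoment p l w K) t) (d - k + 1) else 0 := by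
  have hgeom := geom_nonneg hp0.le hp1
  set x := reMoment p l w K with hxdef
  set y := imMoment p l w K with hydef
  set α := angle x y t
  have hα0 : 0 ≤ α := angle_nonneg hx hy ht
  have hα1 : α ≤ Real.pi / 2 := (Real.arctan_lt_pi_div_two _).le
  have hpi := Real.pi_pos
  by_cases h : 0 < w * d - θ ∧ w * d - θ < Real.pi
  · set A := w * d - (θ + α) with hA
    -- Without the cutoff the inequality is an identity: the imaginary part of exp((l + iw)d - i(θ +
    -- α)) times 1 + (x + iy)/t.
    have h1 : modulus x y t * bump l w θ d =
        Real.exp (l * d) * Real.sin A + t⁻¹ * ∑ k ∈ Finset.range K,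
          geom p k * (Real.exp (l * (d + 1 - k)) * Real.sin (w * (d + 1 - k) - (θ + α))) := by
      have h2 : ∑ k ∈ Finset.range K,
          geom p k * (Real.exp (l * (d + 1 - k)) * Real.sin (w * (d + 1 - k) - (θ + α))) =
          Real.exp (l * d) * (Real.sin A * x + Real.cos A * y) := by
        rw [hxdef, hydef, reMoment, imMoment, Finset.mul_sum, Finset.mul_sum,
          ← Finset.sum_add_distrib, Finset.mul_sum]
        refine Finset.sum_congr rfl fun k _ => ?_
        rw [show l * (d + 1 - k) = l * d + l * (1 - k) by ring,
          show w * (d + 1 - k) - (θ + α) = A + w * (1 - k) by rw [hA]; ring, Real.exp_add,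
          Real.sin_add]
        ring
      have h3 : Real.sin (w * d - θ) = Real.sin A * Real.cos α + Real.cos A * Real.sin α := by
        rw [← Real.sin_add, hA]; ring_nf
      have h4 := modulus_mul_cos x y t
      have h5 := modulus_mul_sin (y := y) hx ht
      rw [h2, bump, if_pos h, h3]
      calc _ = Real.exp (l * d) * (Real.sin A * (modulus x y t * Real.cos α) +
            Real.cos A * (modulus x y t * Real.sin α)) := by ring
        _ = _ := by rw [h4, h5]; field_simp; ring
    rw [h1]
    -- Since α ≤ π/2 and wK ≤ π/2, all angles stay in [-π, 2π], where the cutoff only helps.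
    refine add_le_add (le_bump (by linarith) (by linarith)) ?_
    refine mul_le_mul_of_nonneg_left (Finset.sum_le_sum fun k hk => ?_) (inv_nonneg.2 ht.le)
    have hk' : (k : ℝ) + 1 ≤ K := by exact_mod_cast Finset.mem_range.1 hk
    have hwk : w * (k + 1) ≤ Real.pi / 2 := (mul_le_mul_of_nonneg_left hk' hw.le).trans hwK
    have hk0 : 0 ≤ w * k := by positivity
    have hlow : -Real.pi ≤ w * (d + 1 - k) - (θ + α) := by linarith
    split_ifs with hkd
    · have hc : ((d - k + 1 : ℕ) : ℝ) = d + 1 - k := by push_cast [hkd]; ring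
      refine mul_le_mul_of_nonneg_left ?_ (hgeom k)
      rw [← hc] at hlow ⊢
      refine le_bump hlow ?_
      rw [hc]
      linarith
    -- For k > d the angle lies in [-π, 0], so the missing term was nonpositive.
    · have hkd' : (d : ℝ) + 1 ≤ k := by exact_mod_cast not_le.1 hkd
      refine mul_nonpos_of_nonneg_of_nonpos (hgeom k)
        (mul_nonpos_of_nonneg_of_nonpos (Real.exp_pos _).le
          (Real.sin_nonpos_of_nonpos_of_neg_pi_le ?_ hlow))
      have : w * (d + 1 - k) ≤ 0 := mul_nonpos_of_nonneg_of_nonpos hw.le (by linarith)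
      linarith
  · rw [bump, if_neg h, mul_zero]
    refine add_nonneg (bump_nonneg _ _ _ _) (mul_nonneg (inv_nonneg.2 ht.le)
      (Finset.sum_nonneg fun k _ => ?_))
    split_ifs
    · exact mul_nonneg (hgeom k) (bump_nonneg _ _ _ _)
    · rfl

end Bump

/-- The position of the bump at time `t` if it starts at time `T`. -/
noncomputable def phase (x y : ℝ) (T t : ℕ) : ℝ := ∑ j ∈ Finset.Ico T t, angle x y j

/-- The inverse of the accumulated growth of the bump at time `t` if it starts at time `T`. -/
noncomputable def scale (x y : ℝ) (T t : ℕ) : ℝ := ∏ j ∈ Finset.Ico T t, (modulus x y j)⁻¹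

section Phase

variable {x y : ℝ} {T t : ℕ}

lemma phase_nonneg (hx : 0 < x) (hy : 0 < y) (hT : 0 < T) : 0 ≤ phase x y T t :=
  Finset.sum_nonneg fun _ hj => angle_nonneg hx hy
    (Nat.cast_pos.2 (hT.trans_le (Finset.mem_Ico.1 hj).1))

lemma modulus_pos (hx : 0 < x) {t : ℝ} (ht : 0 < t) : 0 < modulus x y t :=
  lt_of_lt_of_le (by positivity) (le_modulus hx ht)

lemma scale_pos (hx : 0 < x) (hT : 0 < T) : 0 < scale x y T t :=
  Finset.prod_pos fun _ hj => inv_pos.2 (modulus_pos hx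
    (Nat.cast_pos.2 (hT.trans_le (Finset.mem_Ico.1 hj).1)))

/-- Each angle is at most y/t ≤ y (log t - log(t - 1)), which telescopes. -/
lemma phase_le (hx : 0 < x) (hy : 0 < y) {a : ℕ} (ha : 0 < a) (haT : a < T) (hTt : T ≤ t) :
    phase x y T t ≤ y * Real.log (((t : ℝ) - 1) / a) := by
  have ha' : (0 : ℝ) < a := Nat.cast_pos.2 ha
  have haT' : (a : ℝ) + 1 ≤ T := by exact_mod_cast haT
  induction t, hTt using Nat.le_induction with
  | base =>
    rw [phase, Finset.Ico_self, Finset.sum_empty]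
    exact mul_nonneg hy.le (Real.log_nonneg (by rw [one_le_div ha']; linarith))
  | succ t ht ih =>
    have ht' : (T : ℝ) ≤ t := by exact_mod_cast ht
    have ht0 : (0 : ℝ) < t := by linarith
    have ht1 : (0 : ℝ) < t - 1 := by linarith
    rw [phase, Finset.sum_Ico_succ_top ht]
    have h1 := angle_le hx hy ht0
    have h2 : y / t ≤ y * (Real.log ((t : ℝ) / a) - Real.log (((t : ℝ) - 1) / a)) := by
      rw [div_eq_mul_one_div]
      refine mul_le_mul_of_nonneg_left ?_ hy.le
      rw [Real.log_div ht0.ne' ha'.ne', Real.log_div ht1.ne' ha'.ne']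
      have h3 := Real.one_sub_inv_le_log_of_pos (div_pos ht0 ht1)
      rw [Real.log_div ht0.ne' ht1.ne', inv_div, one_sub_div ht0.ne'] at h3
      have h4 : ((t : ℝ) - (t - 1)) / t = 1 / t := by ring
      linarith
    rw [phase] at ih
    push_cast
    rw [add_sub_cancel_right]
    linarith

/-- The moduli are at least 1 + x/t, and x log(1 + 1/(t + x)) ≤ x/(t + x) ≤ log(1 + x/t). -/
lemma scale_le (hx : 0 < x) (hT : 0 < T) (hTt : T ≤ t) :
    scale x y T t ≤ ((T + x) / (t + x)) ^ x := by
  induction t, hTt using Nat.le_induction with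
  | base =>
    have : (0 : ℝ) < T + x := by positivity
    rw [scale, Finset.Ico_self, Finset.prod_empty, div_self this.ne', Real.one_rpow]
  | succ t ht ih =>
    have ht0 : (0 : ℝ) < t := Nat.cast_pos.2 (hT.trans_le ht)
    have htx : 0 < t + x := by positivity
    rw [scale, Finset.prod_Ico_succ_top ht]
    have h1 : ((t + 1 + x) / (t + x)) ^ x ≤ modulus x y t := by
      refine le_trans ?_ (le_modulus hx ht0)
      have h2 := Real.log_le_sub_one_of_pos (show 0 < (t + 1 + x) / (t + x) by positivity)
      have h3 := Real.one_sub_inv_le_log_of_pos (show 0 < 1 + x / t by positivity)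
      have h4 : 1 - (1 + x / t)⁻¹ = ((t + 1 + x) / (t + x) - 1) * x := by field_simp; ring
      rw [Real.rpow_def_of_pos (by positivity), ← Real.le_log_iff_exp_le (by positivity)]
      nlinarith
    have h5 : ((T + x) / ((t + 1 : ℕ) + x)) ^ x =
        ((T + x) / (t + x)) ^ x * (((t + 1 + x) / (t + x)) ^ x)⁻¹ := by
      rw [← Real.inv_rpow (by positivity), ← Real.mul_rpow (by positivity) (by positivity)]
      push_cast
      congr 1
      field_simp
    rw [h5]
    rw [scale] at ih
    exact mul_le_mul ih (inv_anti₀ (by positivity) h1)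
      (inv_nonneg.2 (modulus_pos hx ht0).le) (by positivity)

/-- As t · `angle x y t` tends to y, the phase eventually grows at rate z' in log t for some z'
between z and y; the slack z' - z absorbs the start. -/
lemma eventually_le_phase (hx : 0 < x) (hy : 0 < y) {z : ℝ} (hz : z < y) (hT : 0 < T) :
    ∀ᶠ n : ℕ in atTop, z * Real.log ((n + 1 : ℕ) : ℝ) ≤ phase x y T (n + 1) := by
  obtain ⟨z', hz', hz'y⟩ := exists_between (max_lt hz hy)
  have hz'0 : 0 < z' := (le_max_right _ _).trans_lt hz'
  have hzz' : z < z' := (le_max_left _ _).trans_lt hz'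
  have hlim : Tendsto (fun t : ℝ => t * angle x y t) atTop (𝓝 y) := by
    have h1 : Tendsto (fun t : ℝ => y / (t + x)) atTop (𝓝[≠] 0) := by
      refine tendsto_nhdsWithin_iff.2 ⟨tendsto_const_nhds.div_atTop
        (tendsto_atTop_add_const_right _ _ tendsto_id), ?_⟩
      filter_upwards [eventually_gt_atTop 0] with t ht
      exact (by positivity : 0 < y / (t + x)).ne'
    have h2 : Tendsto (fun u : ℝ => u⁻¹ * Real.arctan u) (𝓝[≠] 0) (𝓝 1) := by
      have h := (Real.hasDerivAt_arctan 0).tendsto_slope_zero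
      simpa using h
    have h3 : Tendsto (fun t : ℝ => y * (t / (t + x))) atTop (𝓝 (y * 1)) := by
      refine Tendsto.const_mul y ?_
      have h4 : Tendsto (fun t : ℝ => 1 - x / (t + x)) atTop (𝓝 (1 - 0)) :=
        (tendsto_const_nhds.div_atTop
          (tendsto_atTop_add_const_right _ _ tendsto_id)).const_sub 1
      rw [sub_zero] at h4
      refine h4.congr' ?_
      filter_upwards [eventually_gt_atTop 0] with t ht
      have : t + x ≠ 0 := by positivity
      field_simp
      ring
    have h5 := h3.mul (h2.comp h1)
    rw [mul_one, mul_one] at h5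
    refine h5.congr' ?_
    filter_upwards [eventually_gt_atTop 0] with t ht
    have : t + x ≠ 0 := by positivity
    simp only [Function.comp, angle]
    field_simp
  have hev := (hlim.comp tendsto_natCast_atTop_atTop).eventually (lt_mem_nhds hz'y)
  obtain ⟨M, hM⟩ := eventually_atTop.1 hev
  set M' := max M T with hM'
  have hM'0 : 0 < M' := hT.trans_le (le_max_right _ _)
  have key : ∀ t, M' ≤ t → z' * (Real.log t - Real.log M') ≤ phase x y T t := by
    intro t ht
    induction t, ht using Nat.le_induction with
    | base => rw [sub_self, mul_zero]; exact phase_nonneg hx hy hT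
    | succ t ht ih =>
      have ht0 : (0 : ℝ) < t := Nat.cast_pos.2 (hM'0.trans_le ht)
      rw [phase, Finset.sum_Ico_succ_top ((le_max_right _ _).trans ht)]
      rw [phase] at ih
      have h1 : z' < t * angle x y t := hM t ((le_max_left _ _).trans ht)
      have h2 : z' / t ≤ angle x y t := by rw [div_le_iff₀ ht0]; linarith
      have h3 := Real.log_le_sub_one_of_pos (show (0 : ℝ) < (t + 1) / t by positivity)
      rw [Real.log_div (by positivity) ht0.ne', add_div, div_self ht0.ne', add_sub_cancel_left]
        at h3
      have h4 := mul_le_mul_of_nonneg_left h3 hz'0.le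
      rw [mul_one_div] at h4
      push_cast
      linarith
  have hlog : Tendsto (fun n : ℕ => Real.log ((n + 1 : ℕ) : ℝ)) atTop atTop :=
    Real.tendsto_log_atTop.comp (tendsto_natCast_atTop_atTop.comp (tendsto_add_atTop_nat 1))
  filter_upwards [hlog.eventually_ge_atTop (z' * Real.log M' / (z' - z)),
    eventually_ge_atTop M'] with n hn1 hn2
  rw [div_le_iff₀ (by linarith)] at hn1
  have := key (n + 1) (by omega)
  linarith

end Phase

/-- Summing a power of exponent less than `-1`. -/
lemma sum_rpow_le {γ : ℝ} (hγ : 0 < γ) {b n : ℕ} (hn : b ≤ n) :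
    ∑ j ∈ Finset.Ico b n, (((j + 1 : ℕ) : ℝ) / ((b + 1 : ℕ) : ℝ)) ^ (-1 - γ) ≤
      2 ^ (1 + γ) / γ * ((b + 1 : ℕ) : ℝ) := by
  have ha : (0 : ℝ) < ((b + 1 : ℕ) : ℝ) := by positivity
  set a : ℝ := ((b + 1 : ℕ) : ℝ)
  -- Strengthened for induction: each term is compared with a difference of (t/a)^(-γ), and 2^(1 +
  -- γ) pays for replacing t by t + 1 ≤ 2t.
  suffices h : ∑ j ∈ Finset.Ico b n, (((j + 1 : ℕ) : ℝ) / a) ^ (-1 - γ) ≤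
      2 ^ (1 + γ) / γ * a * (1 - (((n + 1 : ℕ) : ℝ) / a) ^ (-γ)) by
    refine h.trans (mul_le_of_le_one_right (by positivity) ?_)
    have : 0 ≤ (((n + 1 : ℕ) : ℝ) / a) ^ (-γ) := by positivity
    linarith
  induction n, hn using Nat.le_induction with
  | base =>
    change _ ≤ _ * (1 - (a / a) ^ (-γ))
    rw [div_self ha.ne', Real.one_rpow, sub_self, mul_zero, Finset.Ico_self, Finset.sum_empty]
  | succ n hn ih =>
    rw [Finset.sum_Ico_succ_top hn]
    refine (add_le_add_left ih _).trans ?_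
    have ht : (1 : ℝ) ≤ ((n + 1 : ℕ) : ℝ) := by exact_mod_cast Nat.succ_pos n
    rw [show ((n + 1 + 1 : ℕ) : ℝ) = ((n + 1 : ℕ) : ℝ) + 1 by push_cast; ring]
    set t : ℝ := ((n + 1 : ℕ) : ℝ)
    have ht0 : 0 < t := by linarith
    -- ratio of consecutive terms
    have h1 : (t / a) ^ (-γ) = ((t + 1) / a) ^ (-γ) * ((t + 1) / t) ^ γ := by
      rw [← inv_div t (t + 1), Real.inv_rpow (by positivity), ← Real.rpow_neg (by positivity),
        ← Real.mul_rpow (by positivity) (by positivity)]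
      congr 1
      field_simp
    have h2 : 1 + γ / (t + 1) ≤ ((t + 1) / t) ^ γ := by
      have h3 := Real.one_sub_inv_le_log_of_pos (show 0 < (t + 1) / t by positivity)
      rw [inv_div, one_sub_div (by positivity), add_sub_cancel_left] at h3
      rw [Real.rpow_def_of_pos (by positivity)]
      refine le_trans ?_ (Real.add_one_le_exp _)
      have h4 := mul_le_mul_of_nonneg_right h3 hγ.le
      rw [div_mul_eq_mul_div, one_mul] at h4
      linarith
    have h5 : (t / a) ^ (-1 - γ) ≤ 2 ^ (1 + γ) * ((t + 1) / a) ^ (-1 - γ) := by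
      rw [show -1 - γ = -(1 + γ) by ring, Real.rpow_neg (by positivity),
        Real.rpow_neg (by positivity), inv_eq_one_div, ← div_eq_mul_inv,
        div_le_div_iff₀ (by positivity) (by positivity), one_mul,
        ← Real.mul_rpow (by positivity) (by positivity)]
      refine Real.rpow_le_rpow (by positivity) ?_ (by linarith)
      rw [← mul_div_assoc]
      exact div_le_div_of_nonneg_right (by linarith) ha.le
    have h6 : ((t + 1) / a) ^ (-1 - γ) = ((t + 1) / a) ^ (-γ) * (a / (t + 1)) := by
      rw [show -1 - γ = -γ + -1 by ring, Real.rpow_add (by positivity), Real.rpow_neg_one, inv_div]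
    set X := ((t + 1) / a) ^ (-γ)
    have hX : 0 < X := by positivity
    have h7 : 2 ^ (1 + γ) * (X * (a / (t + 1))) ≤
        2 ^ (1 + γ) / γ * a * ((t / a) ^ (-γ) - X) := by
      rw [h1]
      have h8 := mul_le_mul_of_nonneg_left h2 hX.le
      calc 2 ^ (1 + γ) * (X * (a / (t + 1)))
          = 2 ^ (1 + γ) / γ * a * (X * (1 + γ / (t + 1)) - X) := by field_simp; ring
        _ ≤ _ := by gcongr
    rw [h6] at h5
    nlinarith

/-! ### The lower bound -/

/-- The test function: from time `2 a` on the travelling bump, before that a function that brings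
the `a` oldest vertices, of relative depth `0`, to relative depth `1`. -/
noncomputable def test (p l w x y : ℝ) (a t d : ℕ) : ℝ :=
  if t < 2 * a then
    if d = 0 then Real.exp l * Real.sin w * p * ((2 * a - t) / (2 * a))
    else if d = 1 then Real.exp l * Real.sin w else 0
  else scale x y (2 * a) t * bump l w (phase x y (2 * a) t) d

section Test

variable {p l w : ℝ} {K : ℕ}

lemma test_nonneg {x y : ℝ} (hp0 : 0 < p) (hw : 0 < w) (hwpi : w < Real.pi)
    (hx : 0 < x) {a : ℕ} (ha : 0 < a) (t d : ℕ) : 0 ≤ test p l w x y a t d := by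
  have hs := Real.sin_pos_of_pos_of_lt_pi hw hwpi
  rw [test]
  split_ifs with h1 h2 h3
  · have : (t : ℝ) ≤ 2 * a := by exact_mod_cast h1.le
    have : 0 ≤ (2 * a - (t : ℝ)) / (2 * a) := div_nonneg (by linarith) (by positivity)
    positivity
  · positivity
  · rfl
  · exact mul_nonneg (scale_pos hx (by omega)).le (bump_nonneg _ _ _ _)

lemma test_one {x y : ℝ} (hw : 0 < w) (hwpi : w < Real.pi) {a t : ℕ} (ht : t ≤ 2 * a) :
    test p l w x y a t 1 = Real.exp l * Real.sin w := by
  rcases ht.lt_or_eq with h | rfl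
  · simp [test, h]
  · simp [test, scale, phase, bump, hw, hwpi]

lemma le_test_zero {x y : ℝ} (hx : 0 < x) {a t : ℕ} (ha : 0 < a) (ht : t ≤ 2 * a) :
    Real.exp l * Real.sin w * p * ((2 * a - t) / (2 * a)) ≤ test p l w x y a t 0 := by
  rcases ht.lt_or_eq with h | rfl
  · simp [test, h]
  · have : 0 ≤ test p l w x y a (2 * a) 0 := by
      rw [test, if_neg (lt_irrefl _)]
      exact mul_nonneg (scale_pos hx (by omega)).le (bump_nonneg _ _ _ _)
    simpa using this

lemma one_le_of_imMoment_pos (hy : 0 < imMoment p l w K) : 0 < K := by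
  rcases Nat.eq_zero_or_pos K with rfl | h
  · simp [imMoment] at hy
  · exact h

/-- Before time 2a the weight at depth 0 loses a 1/(2a) share per step, paid for by walks of length
0, which create depth 1 at rate p/t ≥ p/(2a). This warm-up is needed because the initial bump
vanishes at depth 0. From time 2a on, `scale` cancels `modulus`. -/
theorem test_subsolution (hp0 : 0 < p) (hp1 : p ≤ 1) (hw : 0 < w)
    (hwK : w * K ≤ Real.pi / 2) (hx : 0 < reMoment p l w K) (hy : 0 < imMoment p l w K)
    {a t : ℕ} (ha : 0 < a) (hat : a ≤ t) (d : ℕ) :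
    test p l w (reMoment p l w K) (imMoment p l w K) a t d ≤
      test p l w (reMoment p l w K) (imMoment p l w K) a (t + 1) d +
        (t : ℝ)⁻¹ * ∑ k ∈ Finset.range K, if k ≤ d then geom p k *
          test p l w (reMoment p l w K) (imMoment p l w K) a (t + 1) (d - k + 1) else 0 := by
  have hK := one_le_of_imMoment_pos hy
  have hK1 : (1 : ℝ) ≤ K := by exact_mod_cast hK
  have hwpi : w < Real.pi := by nlinarith [Real.pi_pos]
  have hs := Real.sin_pos_of_pos_of_lt_pi hw hwpi
  have hgeom := geom_nonneg hp0.le hp1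
  have ht0 : (0 : ℝ) < t := Nat.cast_pos.2 (ha.trans_le hat)
  set x := reMoment p l w K
  set y := imMoment p l w K
  have hnn : ∀ t d, 0 ≤ test p l w x y a t d := test_nonneg hp0 hw hwpi hx ha
  have hterm : ∀ k, 0 ≤ if k ≤ d then geom p k * test p l w x y a (t + 1) (d - k + 1) else 0 := by
    intro k
    split_ifs
    · exact mul_nonneg (hgeom k) (hnn _ _)
    · rfl
  rcases lt_or_ge t (2 * a) with h | h
  · rcases Nat.eq_zero_or_pos d with rfl | hd
    · have h1 : geom p 0 * (Real.exp l * Real.sin w) ≤ ∑ k ∈ Finset.range K,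
          if k ≤ 0 then geom p k * test p l w x y a (t + 1) (0 - k + 1) else 0 := by
        have := Finset.single_le_sum (fun k _ => hterm k) (Finset.mem_range.2 hK)
        simpa only [le_refl, if_true, zero_tsub, zero_add,
          test_one hw hwpi (show t + 1 ≤ 2 * a from h)] using this
      have h2 := le_test_zero (p := p) (l := l) (w := w) (y := y) hx ha (show t + 1 ≤ 2 * a from h)
      refine le_trans ?_ (add_le_add h2 (mul_le_mul_of_nonneg_left h1 (inv_nonneg.2 ht0.le)))
      rw [test, if_pos h, if_pos rfl]
      have ha0 : (0 : ℝ) < 2 * a := by positivity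
      have h3 : (2 * (a : ℝ))⁻¹ ≤ (t : ℝ)⁻¹ := inv_anti₀ ht0 (by exact_mod_cast h.le)
      have h4 := mul_le_mul_of_nonneg_left h3
        (by positivity : 0 ≤ Real.exp l * Real.sin w * p)
      have h5 : (2 * (a : ℝ) - t) / (2 * a) = (2 * a - (t + 1 : ℕ)) / (2 * a) + (2 * (a : ℝ))⁻¹ := by
        push_cast; field_simp; ring
      rw [h5, geom, pow_zero, one_mul, mul_add]
      linarith
    · refine le_add_of_le_of_nonneg ?_
        (mul_nonneg (inv_nonneg.2 ht0.le) (Finset.sum_nonneg fun k _ => hterm k))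
      by_cases hd1 : d = 1
      · rw [hd1, test_one hw hwpi h.le, test_one hw hwpi h]
      · rw [test, if_pos h, if_neg hd.ne', if_neg hd1]
        exact hnn _ _
  · have h0 : 0 < 2 * a := by omega
    have hkey := modulus_mul_bump_le hp0 hp1 hw hwK hx hy (phase_nonneg hx hy h0 (t := t)) ht0 d
    have hM := modulus_pos (y := y) hx ht0
    have hsc := scale_pos (y := y) hx h0 (t := t + 1)
    have hph : phase x y (2 * a) (t + 1) = phase x y (2 * a) t + angle x y t := by
      rw [phase, Finset.sum_Ico_succ_top h]; rfl
    have hscale : scale x y (2 * a) t = scale x y (2 * a) (t + 1) * modulus x y t := by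
      rw [scale, scale, Finset.prod_Ico_succ_top h, inv_mul_cancel_right₀ hM.ne']
    simp only [test, if_neg (not_lt.2 h), if_neg (not_lt.2 (h.trans (Nat.le_succ t))), hph, hscale]
    rw [mul_assoc]
    refine (mul_le_mul_of_nonneg_left hkey hsc.le).trans_eq ?_
    rw [mul_add, mul_left_comm, Finset.mul_sum]
    congr 2
    refine Finset.sum_congr rfl fun k _ => ?_
    split_ifs
    · ring
    · ring

end Test

/-- With X the time ratio, the squared scale gives X^(-2x), the right end of the bump X^((2l - L)
y/w), and the moment at L X^(φ(L) + η - 1). The exponents add up to -1 - γ, with γ > 0 by `hgap`.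
Before time 2a the ratio is at most 2 and a constant suffices. -/
theorem exists_Ex_test_sq_le {p : unitInterval} (hp0 : 0 < (p : ℝ)) {l w x y L η : ℝ} (hL0 : 0 ≤ L)
    (hL : L ≤ 2 * l) (hη : 0 < η) (hg : 1 ≤ growth p L) (hw : 0 < w) (hwpi : w < Real.pi)
    (hx : 0 < x) (hy : 0 < y)
    (hgap : growth p L + η - L * (y / w) < 2 * (x - l * (y / w))) :
    ∃ C γ : ℝ, 0 ≤ C ∧ 0 < γ ∧ ∀ b n : ℕ, b ≤ n → Ex (webgraph 1 p n) (fun G =>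
      Ex (newHead p G) fun e => test p l w x y (b + 1) (n + 2) (depth (b + 1) G e + 1) ^ 2) ≤
        C * (((n + 1 : ℕ) : ℝ) / ((b + 1 : ℕ) : ℝ)) ^ (-1 - γ) := by
  have hp1 : (p : ℝ) ≤ 1 := p.2.2
  have hs := Real.sin_pos_of_pos_of_lt_pi hw hwpi
  set γ := 2 * x - (2 * l - L) * (y / w) - (growth p L + η) with hγ
  have hγ0 : 0 < γ := by rw [hγ]; linarith
  set κ := Real.exp l * Real.sin w
  have hκ : 0 < κ := mul_pos (Real.exp_pos l) hs
  set B := max 1 (Real.exp L / η)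
  have hB1 : 1 ≤ B := le_max_left _ _
  have hBη : Real.exp L ≤ B * η := by
    rw [← div_le_iff₀ hη]; exact le_max_right _ _
  set C₁ := κ ^ 2 * 2 ^ (1 + γ)
  set C₂ := (2 + x) ^ (2 * x) * Real.exp ((2 * l - L) * (Real.pi / w)) *
    (growth p L * B + Real.exp L)
  have hC₁ : 0 ≤ C₁ := by positivity
  have hC₂ : 0 ≤ C₂ := by
    have := (zero_le_one.trans hg)
    positivity
  refine ⟨C₁ + C₂, γ, add_nonneg hC₁ hC₂, hγ0, fun b n hn => ?_⟩
  have ha : (1 : ℝ) ≤ ((b + 1 : ℕ) : ℝ) := by exact_mod_cast Nat.succ_pos b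
  have hat : ((b + 1 : ℕ) : ℝ) ≤ ((n + 1 : ℕ) : ℝ) := by exact_mod_cast (by omega)
  have ha0 : (0 : ℝ) < ((b + 1 : ℕ) : ℝ) := by linarith
  have ht0 : (0 : ℝ) < ((n + 1 : ℕ) : ℝ) := by linarith
  set X := ((n + 1 : ℕ) : ℝ) / ((b + 1 : ℕ) : ℝ) with hXdef
  have hX : 1 ≤ X := (one_le_div ha0).2 hat
  have hX0 : 0 < X := by linarith
  have hXγ : 0 < X ^ (-1 - γ) := by positivity
  rcases lt_or_ge (n + 2) (2 * (b + 1)) with h | h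
  · have h1 : κ ^ 2 ≤ C₁ * X ^ (-1 - γ) := by
      have h2 : X ≤ 2 := by
        rw [hXdef, div_le_iff₀ ha0]; exact_mod_cast (by omega)
      have h3 : X ^ (1 + γ) ≤ 2 ^ (1 + γ) := Real.rpow_le_rpow hX0.le h2 (by linarith)
      rw [show -1 - γ = -(1 + γ) by ring, Real.rpow_neg hX0.le, ← div_eq_mul_inv,
        le_div_iff₀ (by positivity)]
      exact mul_le_mul_of_nonneg_left h3 (sq_nonneg κ)
    calc _ ≤ Ex (webgraph 1 p n) (fun G => Ex (newHead p G) fun _ => κ ^ 2) := by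
          refine Ex_mono fun G _ => Ex_mono fun e _ =>
            pow_le_pow_left₀ (test_nonneg hp0 hw hwpi hx (Nat.succ_pos b) _ _) ?_ 2
          rw [test, if_pos h, if_neg (Nat.succ_ne_zero _)]
          split_ifs
          · rfl
          · exact hκ.le
      _ = κ ^ 2 := by simp only [Ex_const]
      _ ≤ C₁ * X ^ (-1 - γ) := h1
      _ ≤ _ := mul_le_mul_of_nonneg_right (by linarith) hXγ.le
  · have hT0 : 0 < 2 * (b + 1) := by omega
    set S := scale x y (2 * (b + 1)) (n + 2)
    set θ := phase x y (2 * (b + 1)) (n + 2)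
    have hS0 : 0 < S := scale_pos hx hT0
    have hS : S ^ 2 ≤ (2 + x) ^ (2 * x) * X ^ (-(2 * x)) := by
      have h1 : S ≤ ((2 + x) / X) ^ x := by
        refine (scale_le hx hT0 h).trans (Real.rpow_le_rpow (by positivity) ?_ hx.le)
        rw [hXdef, div_div_eq_mul_div]
        refine div_le_div₀ (by positivity) ?_ ht0 ?_
        · push_cast at ha ⊢; nlinarith
        · push_cast; linarith
      have h2 := pow_le_pow_left₀ hS0.le h1 2
      rw [Real.div_rpow (by positivity) hX0.le, div_pow] at h2
      rwa [Real.rpow_neg hX0.le, ← div_eq_mul_inv, mul_comm 2 x, Real.rpow_mul (by positivity),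
        Real.rpow_mul hX0.le, Real.rpow_two, Real.rpow_two]
    have hθ : θ ≤ y * Real.log X := by
      have := phase_le hx hy (Nat.succ_pos b) (show b + 1 < 2 * (b + 1) by omega) h
      convert this using 3
      rw [hXdef]
      push_cast
      ring
    have hE : Real.exp ((2 * l - L) * ((θ + Real.pi) / w)) ≤
        Real.exp ((2 * l - L) * (Real.pi / w)) * X ^ ((2 * l - L) * (y / w)) := by
      rw [Real.rpow_def_of_pos hX0, ← Real.exp_add]
      refine Real.exp_le_exp.2 ?_
      have h1 := mul_le_mul_of_nonneg_left (div_le_div_of_nonneg_right hθ hw.le)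
        (by linarith : 0 ≤ 2 * l - L)
      rw [add_div, mul_add]
      have h2 : (2 * l - L) * (y * Real.log X / w) = Real.log X * ((2 * l - L) * (y / w)) := by ring
      linarith
    have hM := Ex_Ex_exp_le_rpow hp0 hL0 (by linarith : 1 ≤ growth p L + η) hB1 hBη hn
    calc _ ≤ Ex (webgraph 1 p n) (fun G => Ex (newHead p G) fun e =>
          S ^ 2 * Real.exp ((2 * l - L) * ((θ + Real.pi) / w)) *
            Real.exp (L * (depth (b + 1) G e + 1 : ℕ))) := by
          refine Ex_mono fun G _ => Ex_mono fun e _ => ?_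
          rw [test, if_neg (not_lt.2 h), mul_pow, mul_assoc]
          exact mul_le_mul_of_nonneg_left (bump_sq_le hw hL _) (sq_nonneg S)
      _ = S ^ 2 * Real.exp ((2 * l - L) * ((θ + Real.pi) / w)) *
          Ex (webgraph 1 p n) (fun G => Ex (newHead p G) fun e =>
            Real.exp (L * (depth (b + 1) G e + 1 : ℕ))) := by simp only [Ex_mul_left]
      _ ≤ ((2 + x) ^ (2 * x) * X ^ (-(2 * x))) * (Real.exp ((2 * l - L) * (Real.pi / w)) *
          X ^ ((2 * l - L) * (y / w))) * ((growth p L * B + Real.exp L) *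
            X ^ (growth p L + η - 1)) := by
          gcongr
          exact Ex_nonneg fun _ => Ex_nonneg fun _ => (Real.exp_pos _).le
      _ = C₂ * (X ^ (-(2 * x)) * X ^ ((2 * l - L) * (y / w)) * X ^ (growth p L + η - 1)) := by
          ring
      _ = C₂ * X ^ (-1 - γ) := by
          rw [← Real.rpow_add hX0, ← Real.rpow_add hX0, hγ]
          congr 2
          ring
      _ ≤ _ := mul_le_mul_of_nonneg_right (by linarith) hXγ.le

/-- With probability `1 - O(1 / a)`, the descendants of a set of at least half of the `a` oldest
vertices reach the relative depth `(c - ε) log n`. -/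
theorem exists_Pr_depth_lt_le {p : unitInterval} {s : ℝ} (hp0 : 0 < (p : ℝ)) (hp : (p : ℝ) < 1)
    (h : IsS p s) (hg : 1 ≤ growth p (1 / s)) {ε : ℝ} (hε : 0 < ε) :
    ∃ C : ℝ, ∀ (b : ℕ) (χ : ℕ → ℝ), (∀ i, 0 ≤ χ i) → (∀ i, χ i ≤ 1) →
      ((b + 1 : ℕ) : ℝ) / 2 ≤ ∑ i ∈ Finset.range (b + 1), χ i →
      ∀ᶠ n : ℕ in atTop, Pr (webgraph 1 p n) (fun G => ∀ v, χ (base (b + 1) G v) ≠ 0 →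
        (depth (b + 1) G v : ℝ) < (cL p s - ε) * Real.log ((n + 1 : ℕ) : ℝ)) ≤
          C / ((b + 1 : ℕ) : ℝ) := by
  obtain ⟨l, η, w, K, hl, hL, hη, hw, hwK, hx, hy, hc, hgap⟩ := exists_parameters hp0 hp h hε
  have hL0 : 0 < 1 / s := one_div_pos.2 h.1.1
  have hK1 : (1 : ℝ) ≤ K := by exact_mod_cast one_le_of_imMoment_pos hy
  have hwpi : w < Real.pi := by nlinarith [Real.pi_pos]
  have hs := Real.sin_pos_of_pos_of_lt_pi hw hwpi
  obtain ⟨C, γ, hC, hγ, hV⟩ := exists_Ex_test_sq_le hp0 hL0.le hL hη hg hw hwpi hx hy hgap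
  have hsub := fun (b t : ℕ) (ht : b + 1 ≤ t) (d : ℕ) =>
    test_subsolution hp0 hp.le hw hwK hx hy (Nat.succ_pos b) ht d
  set x := reMoment p l w K
  set y := imMoment p l w K
  set κ := Real.exp l * Real.sin w
  have hκ : 0 < κ := mul_pos (Real.exp_pos l) hs
  refine ⟨C * (2 ^ (1 + γ) / γ) / (κ * p / 4) ^ 2, fun b χ hχ0 hχ1 hχ => ?_⟩
  have ha : (0 : ℝ) < ((b + 1 : ℕ) : ℝ) := by positivity
  have hz : w * (cL p s - ε) < y := by
    rw [lt_div_iff₀ hw] at hc; linarith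
  filter_upwards [eventually_le_phase hx hy hz (T := 2 * (b + 1)) (by omega),
    eventually_ge_atTop (2 * (b + 1))] with n hn1 hn2
  have hnn := test_nonneg (l := l) (y := y) hp0 hw hwpi hx (Nat.succ_pos b)
  have hmain := Ex_sq_max_sub_vertexSum_le (n := n) hp0 hχ0 hχ1 hnn (hsub b) (hV b) (by omega)
  rw [← Finset.mul_sum] at hmain
  have hsum := mul_le_mul_of_nonneg_left (sum_rpow_le hγ (show b ≤ n by omega)) hC
  set M := (∑ i ∈ Finset.range (b + 1), χ i) * test p l w x y (b + 1) (b + 1) 0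
  have htest : test p l w x y (b + 1) (b + 1) 0 = κ * p / 2 := by
    rw [test, if_pos (by omega), if_pos rfl]
    have : (2 * ((b + 1 : ℕ) : ℝ) - ((b + 1 : ℕ) : ℝ)) / (2 * ((b + 1 : ℕ) : ℝ)) = 1 / 2 := by
      field_simp; ring
    rw [this]
    ring
  -- Total weight at least a/2 times the initial value κp/2. Chebyshev then divides an error of
  -- order a by M², of order a².
  have hM : ((b + 1 : ℕ) : ℝ) * (κ * p / 4) ≤ M := by
    have := mul_le_mul_of_nonneg_right hχ (by positivity : 0 ≤ κ * p / 2)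
    simp only [M, htest]
    linarith
  have hM0 : 0 ≤ M := le_trans (by positivity) hM
  have hmarkov := mul_Pr_le (μ := webgraph 1 p n) (c := M ^ 2)
    (q := fun G => ∀ v, χ (base (b + 1) G v) ≠ 0 →
      (depth (b + 1) G v : ℝ) < (cL p s - ε) * Real.log ((n + 1 : ℕ) : ℝ))
    (F := fun G => max (M - vertexSum (b + 1) G fun i d =>
      χ i * test p l w x y (b + 1) (n + 1) d) 0 ^ 2) (fun G => sq_nonneg _) (fun G _ hG => by
      have hzero : vertexSum (b + 1) G (fun i d => χ i * test p l w x y (b + 1) (n + 1) d) = 0 := by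
        refine Finset.sum_eq_zero fun v _ => ?_
        change χ (base (b + 1) G v) * test p l w x y (b + 1) (n + 1) (depth (b + 1) G v) = 0
        by_cases hv : χ (base (b + 1) G v) = 0
        · rw [hv, zero_mul]
        -- At time n + 1 the bump lives where w d exceeds the phase, hence beyond depth (c_L - ε)
        -- log n.
        · have h1 := mul_lt_mul_of_pos_left (hG v hv) hw
          rw [test, if_neg (by omega), bump, if_neg (fun h2 => by linarith [h2.1]), mul_zero,
            mul_zero]
      simp only [hzero, sub_zero, max_eq_left hM0, le_refl])
  have hPr := Pr_nonneg (webgraph 1 p n) (fun G => ∀ v, χ (base (b + 1) G v) ≠ 0 →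
      (depth (b + 1) G v : ℝ) < (cL p s - ε) * Real.log ((n + 1 : ℕ) : ℝ))
  have hM2 := mul_le_mul_of_nonneg_right (pow_le_pow_left₀ (by positivity) hM 2) hPr
  have hfin := hM2.trans (hmarkov.trans (hmain.trans hsum))
  rw [div_div, le_div_iff₀ (by positivity)]
  refine le_of_mul_le_mul_right (a := ((b + 1 : ℕ) : ℝ)) ?_ ha
  calc _ = _ := by ring
    _ ≤ _ := hfin
    _ = _ := by ring

/-- The 2(N + 1) oldest vertices are split into two halves, N being so large that each half fails
with probability at most δ/2. -/
theorem eventually_Pr_diam_lt_le {p : unitInterval} {s : ℝ} (hp0 : 0 < (p : ℝ)) (hp : (p : ℝ) < 1)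
    (h : IsS p s) (hg : 1 ≤ growth p (1 / s)) {ε δ : ℝ} (hε : 0 < ε) (hδ : 0 < δ) :
    ∀ᶠ n : ℕ in atTop, Pr (webgraph 1 p n) (fun G => ((underlying G).diam : ℝ) <
      2 * (cL p s - ε) * Real.log ((n + 1 : ℕ) : ℝ)) ≤ δ := by
  obtain ⟨C, hC⟩ := exists_Pr_depth_lt_le hp0 hp h hg hε
  obtain ⟨N, hN⟩ := exists_nat_gt (C / δ)
  set b := 2 * N + 1 with hb
  have hb1 : ((b + 1 : ℕ) : ℝ) = 2 * (N + 1) := by rw [hb]; push_cast; ring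
  have hCb : C / ((b + 1 : ℕ) : ℝ) ≤ δ / 2 := by
    rw [div_lt_iff₀ hδ] at hN
    rw [hb1, div_le_iff₀ (by positivity)]
    nlinarith
  have hlow : ∑ i ∈ Finset.range (b + 1), (if i < N + 1 then (1 : ℝ) else 0) = N + 1 := by
    rw [← Finset.sum_filter, Finset.sum_const, nsmul_eq_mul, mul_one,
      show (Finset.range (b + 1)).filter (· < N + 1) = Finset.range (N + 1) by
        ext i; simp only [Finset.mem_filter, Finset.mem_range]; omega]
    simp
  have hhigh : ∑ i ∈ Finset.range (b + 1), (if i < N + 1 then (0 : ℝ) else 1) = N + 1 := by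
    have h1 : ∑ i ∈ Finset.range (b + 1), ((if i < N + 1 then (1 : ℝ) else 0) +
        if i < N + 1 then (0 : ℝ) else 1) = (b + 1 : ℕ) := by
      rw [Finset.sum_congr rfl fun i _ => show ((if i < N + 1 then (1 : ℝ) else 0) +
        if i < N + 1 then (0 : ℝ) else 1) = 1 by split_ifs <;> simp]
      simp
    rw [Finset.sum_add_distrib, hlow, hb1] at h1
    linarith
  filter_upwards [hC b (fun i => if i < N + 1 then 1 else 0) (fun i => by split_ifs <;> simp)
      (fun i => by split_ifs <;> simp) (by rw [hlow, hb1]; linarith),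
    hC b (fun i => if i < N + 1 then 0 else 1) (fun i => by split_ifs <;> simp)
      (fun i => by split_ifs <;> simp) (by rw [hhigh, hb1]; linarith)] with n h1 h2
  refine (Pr_le_of_imp (fun G hG hd => ?_)).trans ((Pr_or_le _ _ _).trans
    ((add_le_add h1 h2).trans (by linarith)))
  by_contra! h3
  obtain ⟨⟨v, hv, hv'⟩, u, hu, hu'⟩ := h3
  have h4 := depth_add_depth_le_diam (Nat.succ_pos b) (recursive_of_mem_support hG) (N := N + 1)
    (v := v) (w := u) (by by_contra h5; exact hv (if_neg h5)) (not_lt.1 fun h5 => hu (if_pos h5))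
  have h5 : (depth (b + 1) G v : ℝ) + depth (b + 1) G u ≤ (underlying G).diam := by
    exact_mod_cast h4
  linarith

/-! ### The upper bound -/

theorem eventually_Pr_lt_depth_le {p : unitInterval} {s : ℝ} (hp0 : 0 < (p : ℝ)) (hp : (p : ℝ) < 1)
    (h : IsS p s) (hg : 1 ≤ growth p (1 / s)) {ε δ : ℝ} (hε : 0 < ε) (hδ : 0 < δ) :
    ∀ᶠ n : ℕ in atTop, Pr (webgraph 1 p n) (fun G =>
      ∃ v, (cL p s + ε) * Real.log ((n + 1 : ℕ) : ℝ) < depth 1 G v) ≤ δ := by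
  have hL : 0 < 1 / s := one_div_pos.2 h.1.1
  have hgL := h.growth_eq_mul hp
  set L := 1 / s
  -- As φ(L) = L c_L, the Markov exponent φ(L) + η - L(c_L + ε) is then -η.
  set η := L * ε / 2 with hη
  have hη0 : 0 < η := by positivity
  set B := max 1 (Real.exp L / η)
  have hBη : Real.exp L ≤ B * η := by
    rw [← div_le_iff₀ hη0]; exact le_max_right _ _
  have hlim : Tendsto (fun n : ℕ => B * ((n + 1 : ℕ) : ℝ) ^ (-η)) atTop (𝓝 (B * 0)) :=
    ((tendsto_rpow_neg_atTop hη0).comp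
      (tendsto_natCast_atTop_atTop.comp (tendsto_add_atTop_nat 1))).const_mul B
  rw [mul_zero] at hlim
  filter_upwards [hlim.eventually (gt_mem_nhds hδ)] with n hn
  refine le_trans ?_ hn.le
  have ht : (0 : ℝ) < ((n + 1 : ℕ) : ℝ) := by positivity
  have hmom := Ex_vertexSum_exp_le (b := 0) hp0 hL.le (by linarith : 1 ≤ growth p L + η)
    (le_max_left _ _) hBη (Nat.zero_le n)
  simp only [zero_add, Nat.cast_one, mul_one, div_one] at hmom
  have hmarkov := mul_Pr_le (μ := webgraph 1 p n)
    (c := ((n + 1 : ℕ) : ℝ) ^ (L * (cL p s + ε)))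
    (q := fun G => ∃ v, (cL p s + ε) * Real.log ((n + 1 : ℕ) : ℝ) < depth 1 G v)
    (F := fun G => vertexSum 1 G fun _ d => Real.exp (L * d))
    (fun G => Finset.sum_nonneg fun _ _ => (Real.exp_pos _).le) (fun G _ hG => by
      obtain ⟨v, hv⟩ := hG
      refine le_trans ?_ (Finset.single_le_sum (f := fun v => Real.exp (L * depth 1 G v))
        (fun _ _ => (Real.exp_pos _).le) (Finset.mem_univ v))
      rw [Real.rpow_def_of_pos ht]
      refine Real.exp_le_exp.2 ?_
      have := mul_le_mul_of_nonneg_left hv.le hL.le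
      linarith)
  have hfin := hmarkov.trans hmom
  rw [mul_comm, ← le_div_iff₀ (by positivity), mul_div_assoc, ← Real.rpow_sub ht, hgL] at hfin
  convert hfin using 3
  rw [hη]
  ring

end RandomSurfer

theorem mainTheorem5 :
    (∃! p₀ : ℝ, RandomSurfer.IsThreshold p₀) ∧
    (∀ p : ℝ, 0 < p → p < 1 → ∃! s : ℝ, RandomSurfer.IsS p s) ∧
    ∀ (p₀ : ℝ), RandomSurfer.IsThreshold p₀ →
      ∀ (p : unitInterval), p₀ ≤ (p : ℝ) → (p : ℝ) < 1 →
        ∀ (s : ℝ), RandomSurfer.IsS p s →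
          RandomSurfer.AasAsymptotic (RandomSurfer.tree p) (fun _ T => RandomSurfer.height T)
            (fun n => RandomSurfer.cL p s * Real.log ((n + 1 : ℕ) : ℝ)) ∧
          RandomSurfer.AasAsymptotic (RandomSurfer.tree p) (fun _ T => T.diam)
            (fun n => 2 * RandomSurfer.cL p s * Real.log ((n + 1 : ℕ) : ℝ)) := by
  refine ⟨RandomSurfer.existsUnique_isThreshold,
    fun p hp0 hp => RandomSurfer.existsUnique_isS hp0 hp, fun p₀ h₀ p hp₀ hp s hs => ?_⟩
  have hp0 : 0 < (p : ℝ) := h₀.1.1.trans_le hp₀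
  have hg := RandomSurfer.one_le_growth h₀ hp₀ hp hs
  exact RandomSurfer.aasAsymptotic_of_bounds (hs.cL_pos hp0)
    (fun ε hε δ hδ => RandomSurfer.eventually_Pr_lt_depth_le hp0 hp hs hg hε hδ)
    (fun ε hε δ hδ => RandomSurfer.eventually_Pr_diam_lt_le hp0 hp hs hg hε hδ)
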